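/- Let $N,m\in\mathbb N$, $N\ge 1$, $1<p<\infty$, $1<q<\infty$, and let $p^*=\frac{pN}{N-p}$ if $p<N$, while $p^*\in(p,\infty)$ is arbitrary but fixed if $p\ge N$. Let $G:\mathbb R^m\to[0,\infty)$ be continuous and $V:[0,\infty)\to[0,\infty)$ be measurable, and suppose: (G1) there are a constant $K'>0$ and exponents $\mu_1,\dots,\mu_m$ with $p\,\frac{2q-1}{2q}<\mu_i<p^*\,\frac{2q-1}{2q}$ such that $0\le G(s_1,\dots,s_m)\le K'\sum_{i=1}^m s_i^{\mu_i}$ for all $s_1,\dots,s_m\ge 0$; (G2) $V(|\cdot|)$ belongs to the weak Lebesgue space $L^q_w(\mathbb R^N)$, i.e. $\sup_{h>0}h^q\,|\{x\in\mathbb R^N: V(|x|)\ge h\}|<\infty$, and $N\big(\frac{\mu_i}{p}-\frac{2q-1}{2q}\big)<\frac p2$ for $1\le i\le m$. For $U=(u_1,\dots,u_m)$ consider $Q(U):=G(U)\,[V(|\cdot|)*G(U)]$, where $*$ is the convolution on $\mathbb R^N$. Let $W^{1,p}_{\rm rad}(\mathbb R^N)$ be the space of those elements of $W^{1,p}(\mathbb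 R^N)$ that are radially symmetric about the origin. (a) On the functions $U$ with nonnegative components, the following holds. The map $Q$ is well defined (the convolution integral converges almost everywhere and $Q(U)\in L^1$) and continuous from $\{U\in (L^p\cap L^{p^*})(\mathbb R^N)^m: u_1,\dots,u_m\ge 0 \text{ a.e.}\}$ to $L^1(\mathbb R^N)$. If $N\ge2$, then $Q$ is also well defined and compact from $\{U\in W^{1,p}_{\rm rad}(\mathbb R^N)^m: u_1,\dots,u_m\ge0\text{ a.e.}\}$ to $L^1(\mathbb R^N)$, i.e. it maps subsets that are bounded in $W^{1,p}(\mathbb R^N)^m$ to relatively compact subsets of $L^1(\mathbb R^N)$. (b) If, in addition, $G(s_1,\dots,s_m)\le G(|s_1|,\dots,|s_m|)$ for all $s\in\mathbb R^m$, then the same holds without the sign restriction: $Q$ is well defined and continuous from $(L^p\cap L^{p^*})(\mathbb R^N)^m$ to $L^1(\mathbb R^N)$ and, if $N\ge2$, well defined and compact from $W^{1,p}_{\rm rad}(\mathbb R^N)^m$ to $L^1(\mathbb R^N)$. -/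

import Mathlib

open MeasureTheory
open scoped ENNReal Convolution RealInnerProductSpace

noncomputable section

/-- The space `ℝ^N` with its Euclidean norm and Lebesgue measure. -/
abbrev RN (N : ℕ) : Type := EuclideanSpace ℝ (Fin N)

instance fact_one_le_ofReal {p : ℝ} [h : Fact (1 < p)] : Fact (1 ≤ ENNReal.ofReal p) :=
  ⟨by
    rw [← ENNReal.ofReal_one]
    exact ENNReal.ofReal_le_ofReal h.out.le⟩

/-- `r` is an admissible value of `p^*` in dimension `N`: the critical Sobolev exponent
`pN/(N-p)` if `p < N`, and an arbitrary number in `(p,∞)` if `p ≥ N`. -/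
def IsCriticalExponent (N : ℕ) (p r : ℝ) : Prop :=
  (p < N → r = p * N / (N - p)) ∧ ((N : ℝ) ≤ p → p < r)

/-- Membership in the weak Lebesgue space `L^q_w(ℝ^N)`: `v` is (Lebesgue) measurable and
`sup_{h>0} h^q |{|v| ≥ h}|` is finite. -/
def MemWeakLp {N : ℕ} (v : RN N → ℝ) (q : ℝ) : Prop :=
  AEStronglyMeasurable v volume ∧
    (⨆ (h : ℝ) (_ : 0 < h), ENNReal.ofReal (h ^ q) * volume {x : RN N | h ≤ |v x|}) < ∞

/-- The intersection `(L^p ∩ L^r)(ℝ^N)` of two Lebesgue spaces of real functions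
(modulo equality almost everywhere). -/
def LpInter (N : ℕ) (p r : ℝ) : Type :=
  {u : RN N →ₘ[volume] ℝ //
    u ∈ Lp ℝ (ENNReal.ofReal p) volume ∧ u ∈ Lp ℝ (ENNReal.ofReal r) volume}

namespace LpInter

variable {N : ℕ} {p r : ℝ}

/-- The inclusion of `L^p ∩ L^r` in `L^p × L^r`. -/
def toProd (u : LpInter N p r) :
    Lp ℝ (ENNReal.ofReal p) (volume : Measure (RN N)) ×
      Lp ℝ (ENNReal.ofReal r) (volume : Measure (RN N)) :=
  (⟨u.1, u.2.1⟩, ⟨u.1, u.2.2⟩)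

/-- The topology of `L^p ∩ L^r`, i.e. the one of the norm `max (‖u‖_p) (‖u‖_r)`
(equivalently `‖u‖_p + ‖u‖_r`). -/
instance [Fact (1 < p)] [Fact (1 < r)] : TopologicalSpace (LpInter N p r) :=
  TopologicalSpace.induced toProd inferInstance

end LpInter

/-- `g` is the weak gradient of `u` on `ℝ^N`: `∫ u ∂_v φ = - ∫ (g · v) φ` for all test functions
`φ ∈ C_c^∞(ℝ^N)` and all directions `v`. -/
def IsWeakGradient {N : ℕ} (u : RN N → ℝ) (g : RN N → RN N) : Prop :=
  ∀ φ : RN N → ℝ, ContDiff ℝ (⊤ : ℕ∞) φ → HasCompactSupport φ → ∀ v : RN N,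
    ∫ x, u x * fderiv ℝ φ x v = - ∫ x, ⟪g x, v⟫ * φ x

/-- `u` is radially symmetric about the origin (up to a null set). -/
def IsRadialAE {N : ℕ} (u : RN N → ℝ) : Prop :=
  ∃ f : ℝ → ℝ, ∀ᵐ x : RN N, u x = f ‖x‖

/-- The product `L^p(ℝ^N) × L^p(ℝ^N; ℝ^N)`, in which `W^{1,p}(ℝ^N)` is embedded through
`u ↦ (u, Du)`; its norm induces (a norm equivalent to) the norm of `W^{1,p}(ℝ^N)`. -/
abbrev LpPair (N : ℕ) (p : ℝ) : Type :=
  Lp ℝ (ENNReal.ofReal p) (volume : Measure (RN N)) ×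
    Lp (RN N) (ENNReal.ofReal p) (volume : Measure (RN N))

/-- The radially symmetric elements `u` of the Sobolev space `W^{1,p}(ℝ^N)`, each given as the
pair `(u, Du)`. -/
def SobolevRadial (N : ℕ) (p : ℝ) : Set (LpPair N p) :=
  {w | IsWeakGradient (w.1 : RN N → ℝ) (w.2 : RN N → RN N) ∧ IsRadialAE (w.1 : RN N → ℝ)}

/-- `U` has nonnegative components (almost everywhere). -/
def NonnegAE {N m : ℕ} (U : Fin m → RN N → ℝ) : Prop :=
  ∀ i, ∀ᵐ x, 0 ≤ U i x

/-- The composition `x ↦ G(U(x))`. -/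
def compG {N m : ℕ} (G : (Fin m → ℝ) → ℝ) (U : Fin m → RN N → ℝ) : RN N → ℝ :=
  fun x => G (fun i => U i x)

/-- `w` is (a representative modulo null sets of) the function `G(U) [V(|·|) * G(U)]`, where the
integral defining the convolution exists almost everywhere. -/
def IsNonlocalTerm {N m : ℕ} (G : (Fin m → ℝ) → ℝ) (V : ℝ → ℝ) (U : Fin m → RN N → ℝ)
    (w : RN N → ℝ) : Prop :=
  (∀ᵐ x, ConvolutionExistsAt (fun z : RN N => V ‖z‖) (compG G U) x
      (ContinuousLinearMap.mul ℝ ℝ) volume) ∧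
    ∀ᵐ x, w x = compG G U x *
      ((fun z : RN N => V ‖z‖) ⋆[ContinuousLinearMap.mul ℝ ℝ, volume] compG G U) x

/-- The map `U ↦ G(U) [V(|·|) * G(U)]` is well defined and continuous from the subset `D` of
`(L^p ∩ L^r)(ℝ^N)^m` to `L^1(ℝ^N)`. -/
def NonlocalContinuousOn {N m : ℕ} {p r : ℝ} [Fact (1 < p)] [Fact (1 < r)]
    (G : (Fin m → ℝ) → ℝ) (V : ℝ → ℝ) (D : Set (Fin m → LpInter N p r)) : Prop :=
  ∃ Q : D → Lp ℝ 1 (volume : Measure (RN N)),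
    (∀ U : D, IsNonlocalTerm G V (fun i => ((U.1 i).1 : RN N → ℝ)) (Q U)) ∧ Continuous Q

/-- The map `U ↦ G(U) [V(|·|) * G(U)]` is well defined from the set `D` of functions `U`
(given as the tuples of pairs `(u_i, Du_i)`) to `L^1(ℝ^N)`, and it is compact: it maps bounded
(in `(W^{1,p})^m`) subsets of `D` to relatively compact subsets of `L^1(ℝ^N)`. -/
def NonlocalCompactOn {N m : ℕ} {p : ℝ} [Fact (1 < p)]
    (G : (Fin m → ℝ) → ℝ) (V : ℝ → ℝ) (D : Set (Fin m → LpPair N p)) : Prop :=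
  ∃ Q : D → Lp ℝ 1 (volume : Measure (RN N)),
    (∀ U : D, IsNonlocalTerm G V (fun i => ((U.1 i).1 : RN N → ℝ)) (Q U)) ∧
      ∀ B : Set D, Bornology.IsBounded B → IsCompact (closure (Q '' B))

end

/-! The nonlocal term is quadratic in the scalar function G(U). Two things are therefore needed: a
bound ∫ f (V * g) ≤ C ‖f‖_a ‖g‖_a, and continuity of U ↦ G(U) into L^a. At the natural exponent a =
2q/(2q-1) the kernel is only in weak L^q. The strict inequalities on the μ_i make it possible to
avoid this endpoint. Cutting V at height 1 gives a piece in L^{b₁} and a piece in L^{b₂} with b₁ < q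
< b₂, and the ordinary Young inequality applies to each (`MemWeakLp.exists_young_bound`). If b₁, b₂
are close to q and a_j = 2b_j/(2b_j-1), every μ_i a_j still lies in the open interval (p, p^*)
(`exists_isAdmissible`).

By the growth of G, only the L^s norms of U with p < s < p^* matter. One sequential statement,
`IsAdmissible.tendsto_of_isNonlocalTerm`, then serves both halves of the theorem: if U_n → U a.e.
and in every such L^s, the nonlocal terms converge in L^1. On L^p ∩ L^{p^*} this convergence comes
from interpolation and from passing to a.e. convergent subsequences.

For compactness, bounded sets of radial W^{1,p} functions must be relatively compact in these L^s.
Integrating the gradient of a mollification along rays, averaging over the sphere and applying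
Hölder bounds |u(y) - u(x)| by ‖Du‖_p and the integral of τ^{-(N-1)/(p-1)} between the two radii
(`IsWeakGradient.exists_osc_le`). This single estimate gives Strauss' decay |x|^{-(N-1)/p}, a bound
|x|^{-α} near the origin with αs < N, and a Hölder modulus away from the origin. The modulus and a
diagonal argument produce a pointwise convergent subsequence. The bound near the origin gives
dominated convergence on balls, and the decay, which is genuine for N ≥ 2, makes the tails uniformly
small (`exists_subseq_tendsto_sobolevRadial`). The Sobolev embedding theorem is not used. -/

section

open Filter Set Topology

/-! ### Young's inequality for kernels in weak Lebesgue spaces -/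

/-- Young's inequality for the trilinear convolution form, with exponents `a = 2b/(2b-1)`. -/
theorem lintegral_mul_lconvolution_le {N : ℕ} {b : ℝ} (hb : 1 < b) {f W g : RN N → ℝ≥0∞}
    (hf : AEMeasurable f volume) (hW : AEMeasurable W volume) (hg : AEMeasurable g volume) :
    ∫⁻ x, f x * ∫⁻ t, W t * g (x - t) ≤
      (∫⁻ x, f x ^ (2 * b / (2 * b - 1))) ^ ((2 * b - 1) / (2 * b)) *
      (∫⁻ x, W x ^ b) ^ (1 / b) *
      (∫⁻ x, g x ^ (2 * b / (2 * b - 1))) ^ ((2 * b - 1) / (2 * b)) := by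
  set a := 2 * b / (2 * b - 1) with ha
  have hb0 : 0 < b := by linarith
  have hb1 : 0 < 2 * b - 1 := by linarith
  have hθ1 : 0 ≤ 1 - 1 / b := by
    rw [sub_nonneg, div_le_one hb0]; exact hb.le
  have hθ2 : 0 ≤ 1 / (2 * b) := by positivity
  have ha0 : 0 ≤ a := by positivity
  have hgsub : AEMeasurable (fun z : RN N × RN N => g (z.1 - z.2)) (volume.prod volume) :=
    hg.comp_quasiMeasurePreserving
      (quasiMeasurePreserving_sub_of_right_invariant volume volume)
  have hf1 : AEMeasurable (fun z : RN N × RN N => f z.1) (volume.prod volume) := hf.comp_fst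
  have hW1 : AEMeasurable (fun z : RN N × RN N => W z.2) (volume.prod volume) := hW.comp_snd
  have hgx : ∀ x : RN N, AEMeasurable (fun t => g (x - t)) volume := fun x =>
    hg.comp_quasiMeasurePreserving (quasiMeasurePreserving_sub_left_of_right_invariant volume x)
  have htrans : ∀ t : RN N, ∫⁻ x, g (x - t) ^ a = ∫⁻ x, g x ^ a := fun t =>
    lintegral_sub_right_eq_self (fun x => g x ^ a) t
  have hrefl : ∀ x : RN N, ∫⁻ t, g (x - t) ^ a = ∫⁻ x, g x ^ a := fun x =>
    lintegral_sub_left_eq_self (fun x => g x ^ a) x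
  set Φ := ∫⁻ x, f x ^ a
  set Γ := ∫⁻ x, g x ^ a
  set Ω := ∫⁻ x, W x ^ b
  -- Three-factor Hölder on the product space: f W g = (f^a g^a)^{1-1/b} (f^a W^b)^{1/(2b)} (W^b
  -- g^a)^{1/(2b)}, valid because a(1-1/b) + a/(2b) = 1. Each pair of factors integrates to a
  -- product, by Tonelli and translation invariance.
  let F : Fin 3 → RN N × RN N → ℝ≥0∞ :=
    ![fun z => f z.1 ^ a * g (z.1 - z.2) ^ a, fun z => f z.1 ^ a * W z.2 ^ b,
      fun z => W z.2 ^ b * g (z.1 - z.2) ^ a]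
  let e : Fin 3 → ℝ := ![1 - 1 / b, 1 / (2 * b), 1 / (2 * b)]
  have hF : ∀ i ∈ Finset.univ, AEMeasurable (F i) (volume.prod volume) := by
    intro i _
    fin_cases i
    · exact (hf1.pow_const _).mul (hgsub.pow_const _)
    · exact (hf1.pow_const _).mul (hW1.pow_const _)
    · exact (hW1.pow_const _).mul (hgsub.pow_const _)
  have key := ENNReal.lintegral_prod_norm_pow_le (μ := (volume : Measure (RN N)).prod volume)
    Finset.univ (f := F) hF (p := e)
    (by simp only [Fin.sum_univ_three, e]; simp; field_simp; ring)
    (by intro i _; fin_cases i <;> first | exact hθ1 | exact hθ2)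
  simp only [Fin.prod_univ_three, F, e, Matrix.cons_val_zero, Matrix.cons_val_one,
    Matrix.cons_val] at key
  have hI1 : ∫⁻ z : RN N × RN N, f z.1 ^ a * g (z.1 - z.2) ^ a ∂(volume.prod volume) = Φ * Γ := by
    rw [lintegral_prod _ ((hf1.pow_const _).fun_mul (hgsub.pow_const _))]
    simp only
    rw [← lintegral_mul_const'' _ (hf.pow_const _)]
    refine lintegral_congr fun x => ?_
    rw [lintegral_const_mul'' _ ((hgx x).pow_const _), hrefl]
  have hI2 : ∫⁻ z : RN N × RN N, f z.1 ^ a * W z.2 ^ b ∂(volume.prod volume) = Φ * Ω :=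
    lintegral_prod_mul (hf.pow_const _) (hW.pow_const _)
  have hI3 : ∫⁻ z : RN N × RN N, W z.2 ^ b * g (z.1 - z.2) ^ a ∂(volume.prod volume) = Ω * Γ := by
    rw [lintegral_prod_symm _ ((hW1.pow_const _).fun_mul (hgsub.pow_const _))]
    simp only
    rw [← lintegral_mul_const'' _ (hW.pow_const _)]
    refine lintegral_congr fun t => ?_
    rw [lintegral_const_mul'', htrans]
    exact (hg.comp_quasiMeasurePreserving
      (measurePreserving_sub_right volume t).quasiMeasurePreserving).pow_const _
  rw [hI1, hI2, hI3] at key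
  have hea : a * (1 - 1 / b) + a * (1 / (2 * b)) = 1 := by rw [ha]; field_simp; ring
  have hlhs : ∫⁻ x, f x * ∫⁻ t, W t * g (x - t) =
      ∫⁻ z : RN N × RN N, (f z.1 ^ a * g (z.1 - z.2) ^ a) ^ (1 - 1 / b) *
        (f z.1 ^ a * W z.2 ^ b) ^ (1 / (2 * b)) * (W z.2 ^ b * g (z.1 - z.2) ^ a) ^ (1 / (2 * b))
          ∂(volume.prod volume) := by
    have hpt : ∀ z : RN N × RN N, (f z.1 ^ a * g (z.1 - z.2) ^ a) ^ (1 - 1 / b) *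
        (f z.1 ^ a * W z.2 ^ b) ^ (1 / (2 * b)) * (W z.2 ^ b * g (z.1 - z.2) ^ a) ^ (1 / (2 * b))
        = f z.1 * (W z.2 * g (z.1 - z.2)) := by
      intro z
      rw [ENNReal.mul_rpow_of_nonneg _ _ hθ1, ENNReal.mul_rpow_of_nonneg _ _ hθ2,
        ENNReal.mul_rpow_of_nonneg _ _ hθ2]
      simp only [← ENNReal.rpow_mul]
      have h1 : f z.1 ^ (a * (1 - 1 / b)) * f z.1 ^ (a * (1 / (2 * b))) = f z.1 := by
        rw [← ENNReal.rpow_add_of_nonneg _ _ (mul_nonneg ha0 hθ1) (mul_nonneg ha0 hθ2), hea,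
          ENNReal.rpow_one]
      have h2 : g (z.1 - z.2) ^ (a * (1 - 1 / b)) * g (z.1 - z.2) ^ (a * (1 / (2 * b)))
          = g (z.1 - z.2) := by
        rw [← ENNReal.rpow_add_of_nonneg _ _ (mul_nonneg ha0 hθ1) (mul_nonneg ha0 hθ2), hea,
          ENNReal.rpow_one]
      have h3 : W z.2 ^ (b * (1 / (2 * b))) * W z.2 ^ (b * (1 / (2 * b))) = W z.2 := by
        rw [← ENNReal.rpow_add_of_nonneg _ _ (mul_nonneg hb0.le hθ2) (mul_nonneg hb0.le hθ2)]
        have : b * (1 / (2 * b)) + b * (1 / (2 * b)) = 1 := by field_simp; norm_num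
        rw [this, ENNReal.rpow_one]
      conv_rhs => rw [← h1, ← h2, ← h3]
      ring
    simp only [hpt]
    rw [lintegral_prod _ (hf1.fun_mul (hW1.fun_mul hgsub))]
    refine lintegral_congr fun x => ?_
    exact (lintegral_const_mul'' _ (hW.fun_mul (hgx x))).symm
  rw [hlhs]
  refine key.trans (le_of_eq ?_)
  rw [ENNReal.mul_rpow_of_nonneg _ _ hθ1, ENNReal.mul_rpow_of_nonneg _ _ hθ2,
    ENNReal.mul_rpow_of_nonneg _ _ hθ2]
  have he : (2 * b - 1) / (2 * b) = (1 - 1 / b) + 1 / (2 * b) := by field_simp; ring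
  have he2 : 1 / b = 1 / (2 * b) + 1 / (2 * b) := by field_simp; norm_num
  rw [he, ENNReal.rpow_add_of_nonneg _ _ hθ1 hθ2, ENNReal.rpow_add_of_nonneg _ _ hθ1 hθ2]
  conv_rhs => rw [he2, ENNReal.rpow_add_of_nonneg _ _ hθ2 hθ2, ← he2]
  ring

theorem lintegral_Ioi_one_rpow_lt_top {s : ℝ} (hs : s < -1) :
    ∫⁻ t in Ioi (1 : ℝ), ENNReal.ofReal (t ^ s) < ∞ := by
  have h := (integrableOn_Ioi_rpow_of_lt hs one_pos).hasFiniteIntegral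
  rw [hasFiniteIntegral_iff_ofReal] at h
  · exact h
  · filter_upwards [ae_restrict_mem measurableSet_Ioi] with t ht
    exact Real.rpow_nonneg (zero_le_one.trans (le_of_lt ht)) _

theorem lintegral_Ioc_zero_one_rpow_lt_top {s : ℝ} (hs : -1 < s) :
    ∫⁻ t in Ioc (0 : ℝ) 1, ENNReal.ofReal (t ^ s) < ∞ := by
  have h := ((intervalIntegrable_iff_integrableOn_Ioc_of_le zero_le_one).1
    (intervalIntegral.intervalIntegrable_rpow' (a := 0) (b := 1) hs)).hasFiniteIntegral
  rw [hasFiniteIntegral_iff_ofReal] at h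
  · exact h
  · filter_upwards [ae_restrict_mem measurableSet_Ioc] with t ht
    exact Real.rpow_nonneg ht.1.le _

/-- A nonnegative function of weak `L^q` is the sum of a function in `L^{b₁}` (its large values)
and one in `L^{b₂}` (its small values) whenever `b₁ < q < b₂`. -/
theorem MemWeakLp.exists_split {N : ℕ} {v : RN N → ℝ} {q b₁ b₂ : ℝ} (hv : MemWeakLp v q)
    (hv0 : ∀ x, 0 ≤ v x) (hb₁ : 0 < b₁) (h1 : b₁ < q) (h2 : q < b₂) :
    ∃ W₁ W₂ : RN N → ℝ≥0∞, AEMeasurable W₁ volume ∧ AEMeasurable W₂ volume ∧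
      (∀ x, ENNReal.ofReal (v x) = W₁ x + W₂ x) ∧ ∫⁻ x, W₁ x ^ b₁ < ∞ ∧ ∫⁻ x, W₂ x ^ b₂ < ∞ := by
  classical
  obtain ⟨hvm, hsup⟩ := hv
  set S := ⨆ (h : ℝ) (_ : 0 < h), ENNReal.ofReal (h ^ q) * volume {x : RN N | h ≤ |v x|} with hS
  have hb₂ : 0 < b₂ := by linarith
  have hle : ∀ h : ℝ, 0 < h → volume {x : RN N | h ≤ v x} ≤ S * ENNReal.ofReal (h ^ (-q)) := by
    intro h hh
    have h3 : ENNReal.ofReal (h ^ q) * volume {x : RN N | h ≤ v x} ≤ S := by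
      have := le_iSup₂ (f := fun (h : ℝ) (_ : 0 < h) =>
        ENNReal.ofReal (h ^ q) * volume {x : RN N | h ≤ |v x|}) h hh
      simp only [abs_of_nonneg (hv0 _)] at this hS ⊢
      rw [hS]; exact this
    calc volume {x : RN N | h ≤ v x}
        = ENNReal.ofReal (h ^ q * h ^ (-q)) * volume {x : RN N | h ≤ v x} := by
          rw [← Real.rpow_add hh]; simp
      _ = ENNReal.ofReal (h ^ q) * volume {x : RN N | h ≤ v x} * ENNReal.ofReal (h ^ (-q)) := by
          rw [ENNReal.ofReal_mul (by positivity)]; ring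
      _ ≤ _ := by gcongr
  -- Cut at height 1. In the layer-cake integrals below, large heights converge for `v₁` because b₁
  -- < q, and small heights for `v₂` because q < b₂. The remaining range is harmless: superlevel
  -- sets of `v₁` lie in {v ≥ 1}, and those of `v₂` above height 1 are empty.
  let v₁ : RN N → ℝ := fun x => if 1 ≤ v x then v x else 0
  let v₂ : RN N → ℝ := fun x => if 1 ≤ v x then 0 else v x
  have hmv : AEMeasurable v volume := hvm.aemeasurable
  have hφ : Measurable fun t : ℝ => if 1 ≤ t then t else 0 :=
    Measurable.ite measurableSet_Ici measurable_id measurable_const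
  have hφ' : Measurable fun t : ℝ => if 1 ≤ t then 0 else t :=
    Measurable.ite measurableSet_Ici measurable_const measurable_id
  have hv₁m : AEMeasurable v₁ volume := hφ.comp_aemeasurable hmv
  have hv₂m : AEMeasurable v₂ volume := hφ'.comp_aemeasurable hmv
  have hv₁0 : ∀ x, 0 ≤ v₁ x := fun x => by simp only [v₁]; split_ifs <;> simp [hv0]
  have hv₂0 : ∀ x, 0 ≤ v₂ x := fun x => by simp only [v₂]; split_ifs <;> simp [hv0]
  refine ⟨fun x => ENNReal.ofReal (v₁ x), fun x => ENNReal.ofReal (v₂ x), hv₁m.ennreal_ofReal,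
    hv₂m.ennreal_ofReal, ?_, ?_, ?_⟩
  · intro x
    simp only [v₁, v₂]
    split_ifs <;> simp
  · have h0 : ∀ x, ENNReal.ofReal (v₁ x) ^ b₁ = ENNReal.ofReal (v₁ x ^ b₁) := fun x =>
      ENNReal.ofReal_rpow_of_nonneg (hv₁0 x) hb₁.le
    simp only [h0]
    rw [lintegral_rpow_eq_lintegral_meas_le_mul _ (Eventually.of_forall hv₁0) hv₁m hb₁]
    refine ENNReal.mul_lt_top ENNReal.ofReal_lt_top ?_
    rw [← Ioc_union_Ioi_eq_Ioi (zero_le_one (α := ℝ)), lintegral_union measurableSet_Ioi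
      (Set.disjoint_left.2 fun t ht ht' => not_lt.2 ht.2 ht')]
    refine ENNReal.add_lt_top.2 ⟨?_, ?_⟩
    · calc ∫⁻ t in Ioc (0 : ℝ) 1, volume {x | t ≤ v₁ x} * ENNReal.ofReal (t ^ (b₁ - 1))
          ≤ ∫⁻ t in Ioc (0 : ℝ) 1, S * ENNReal.ofReal (t ^ (b₁ - 1)) := by
            refine setLIntegral_mono' measurableSet_Ioc fun t ht => ?_
            gcongr
            refine (measure_mono ?_).trans ((hle 1 one_pos).trans (by simp))
            intro x hx
            by_contra hcon
            have h4 : v₁ x = 0 := if_neg hcon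
            simp only [mem_ofPred_eq, h4] at hx
            exact not_lt.2 hx ht.1
        _ < ∞ := by
            rw [lintegral_const_mul' _ _ hsup.ne]
            exact ENNReal.mul_lt_top hsup (lintegral_Ioc_zero_one_rpow_lt_top (by linarith))
    · calc ∫⁻ t in Ioi (1 : ℝ), volume {x | t ≤ v₁ x} * ENNReal.ofReal (t ^ (b₁ - 1))
          ≤ ∫⁻ t in Ioi (1 : ℝ), S * ENNReal.ofReal (t ^ (b₁ - 1 - q)) := by
            refine setLIntegral_mono' measurableSet_Ioi fun t ht => ?_
            have ht0 : 0 < t := zero_lt_one.trans ht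
            have h5 : volume {x | t ≤ v₁ x} ≤ S * ENNReal.ofReal (t ^ (-q)) := by
              refine (measure_mono ?_).trans (hle t ht0)
              intro x hx
              refine (show t ≤ v₁ x from hx).trans ?_
              simp only [v₁]; split_ifs <;> simp [hv0]
            calc _ ≤ S * ENNReal.ofReal (t ^ (-q)) * ENNReal.ofReal (t ^ (b₁ - 1)) := by gcongr
              _ = _ := by
                rw [mul_assoc, ← ENNReal.ofReal_mul (by positivity), ← Real.rpow_add ht0]
                ring_nf
        _ < ∞ := by
            rw [lintegral_const_mul' _ _ hsup.ne]
            exact ENNReal.mul_lt_top hsup (lintegral_Ioi_one_rpow_lt_top (by linarith))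
  · have h0 : ∀ x, ENNReal.ofReal (v₂ x) ^ b₂ = ENNReal.ofReal (v₂ x ^ b₂) := fun x =>
      ENNReal.ofReal_rpow_of_nonneg (hv₂0 x) hb₂.le
    simp only [h0]
    rw [lintegral_rpow_eq_lintegral_meas_le_mul _ (Eventually.of_forall hv₂0) hv₂m hb₂]
    refine ENNReal.mul_lt_top ENNReal.ofReal_lt_top ?_
    rw [← Ioc_union_Ioi_eq_Ioi (zero_le_one (α := ℝ)), lintegral_union measurableSet_Ioi
      (Set.disjoint_left.2 fun t ht ht' => not_lt.2 ht.2 ht')]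
    refine ENNReal.add_lt_top.2 ⟨?_, ?_⟩
    · calc ∫⁻ t in Ioc (0 : ℝ) 1, volume {x | t ≤ v₂ x} * ENNReal.ofReal (t ^ (b₂ - 1))
          ≤ ∫⁻ t in Ioc (0 : ℝ) 1, S * ENNReal.ofReal (t ^ (b₂ - 1 - q)) := by
            refine setLIntegral_mono' measurableSet_Ioc fun t ht => ?_
            have ht0 : 0 < t := ht.1
            have h5 : volume {x | t ≤ v₂ x} ≤ S * ENNReal.ofReal (t ^ (-q)) := by
              refine (measure_mono ?_).trans (hle t ht0)
              intro x hx
              refine (show t ≤ v₂ x from hx).trans ?_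
              simp only [v₂]; split_ifs <;> simp [hv0]
            calc _ ≤ S * ENNReal.ofReal (t ^ (-q)) * ENNReal.ofReal (t ^ (b₂ - 1)) := by gcongr
              _ = _ := by
                rw [mul_assoc, ← ENNReal.ofReal_mul (by positivity), ← Real.rpow_add ht0]
                ring_nf
        _ < ∞ := by
            rw [lintegral_const_mul' _ _ hsup.ne]
            exact ENNReal.mul_lt_top hsup (lintegral_Ioc_zero_one_rpow_lt_top (by linarith))
    · refine lt_of_le_of_lt (le_of_eq ?_) ENNReal.zero_lt_top
      refine setLIntegral_eq_zero measurableSet_Ioi fun t ht => ?_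
      have h6 : {x | t ≤ v₂ x} = ∅ := by
        ext x
        simp only [mem_ofPred_eq, mem_empty_iff_false, iff_false, not_le, v₂]
        split_ifs with h7
        · exact zero_lt_one.trans ht
        · exact (not_le.1 h7).trans ht
      simp [h6]

/-- The weak Young inequality with a little room in the exponents. -/
theorem MemWeakLp.exists_young_bound {N : ℕ} {v : RN N → ℝ} {q b₁ b₂ : ℝ} (hv : MemWeakLp v q)
    (hv0 : ∀ x, 0 ≤ v x) (hb₁ : 1 < b₁) (h1 : b₁ < q) (h2 : q < b₂) :
    ∃ C : ℝ≥0∞, C < ∞ ∧ ∀ f g : RN N → ℝ≥0∞, AEMeasurable f volume → AEMeasurable g volume →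
      ∫⁻ x, f x * ∫⁻ t, ENNReal.ofReal (v t) * g (x - t) ≤
        C * ((∫⁻ x, f x ^ (2 * b₁ / (2 * b₁ - 1))) ^ ((2 * b₁ - 1) / (2 * b₁)) *
            (∫⁻ x, g x ^ (2 * b₁ / (2 * b₁ - 1))) ^ ((2 * b₁ - 1) / (2 * b₁)) +
          (∫⁻ x, f x ^ (2 * b₂ / (2 * b₂ - 1))) ^ ((2 * b₂ - 1) / (2 * b₂)) *
            (∫⁻ x, g x ^ (2 * b₂ / (2 * b₂ - 1))) ^ ((2 * b₂ - 1) / (2 * b₂))) := by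
  obtain ⟨W₁, W₂, hm₁, hm₂, hsum, hf₁, hf₂⟩ := hv.exists_split hv0 (by linarith) h1 h2
  have hb₂ : 1 < b₂ := by linarith
  refine ⟨(∫⁻ x, W₁ x ^ b₁) ^ (1 / b₁) + (∫⁻ x, W₂ x ^ b₂) ^ (1 / b₂), ?_, ?_⟩
  · exact ENNReal.add_lt_top.2 ⟨ENNReal.rpow_lt_top_of_nonneg (by positivity) hf₁.ne,
      ENNReal.rpow_lt_top_of_nonneg (by positivity) hf₂.ne⟩
  intro f g hf hg
  have hgx : ∀ x : RN N, AEMeasurable (fun t => g (x - t)) volume := fun x =>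
    hg.comp_quasiMeasurePreserving (quasiMeasurePreserving_sub_left_of_right_invariant volume x)
  have hgsub : AEMeasurable (fun z : RN N × RN N => g (z.1 - z.2)) (volume.prod volume) :=
    hg.comp_quasiMeasurePreserving
      (quasiMeasurePreserving_sub_of_right_invariant volume volume)
  have hsplit : ∫⁻ x, f x * ∫⁻ t, ENNReal.ofReal (v t) * g (x - t) =
      (∫⁻ x, f x * ∫⁻ t, W₁ t * g (x - t)) + ∫⁻ x, f x * ∫⁻ t, W₂ t * g (x - t) := by
    rw [← lintegral_add_left']
    · refine lintegral_congr fun x => ?_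
      rw [← mul_add, ← lintegral_add_left' (hm₁.fun_mul (hgx x))]
      simp only [hsum, add_mul]
    · exact hf.mul (hm₁.comp_snd.mul hgsub).lintegral_prod_right'
  rw [hsplit]
  refine (add_le_add (lintegral_mul_lconvolution_le hb₁ hf hm₁ hg)
    (lintegral_mul_lconvolution_le hb₂ hf hm₂ hg)).trans ?_
  rw [mul_add]
  refine add_le_add ?_ ?_
  · rw [mul_right_comm, mul_comm]
    gcongr
    exact le_self_add
  · rw [mul_right_comm, mul_comm]
    gcongr
    exact le_add_self

/-! ### Superposition operators between Lebesgue spaces -/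

/-- Convergence of integrals under a domination by a fixed integrable function up to errors
tending to zero in `L¹`. -/
theorem tendsto_lintegral_zero_of_le_add {α : Type*} [MeasurableSpace α] {ν : Measure α}
    {F R : ℕ → α → ℝ≥0∞} {H : α → ℝ≥0∞} (hF : ∀ n, AEMeasurable (F n) ν)
    (hR : ∀ n, AEMeasurable (R n) ν) (hHm : AEMeasurable H ν)
    (hle : ∀ n, ∀ᵐ x ∂ν, F n x ≤ R n x + H x) (hH : ∫⁻ x, H x ∂ν ≠ ∞)
    (hR0 : Tendsto (fun n => ∫⁻ x, R n x ∂ν) atTop (𝓝 0))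
    (hF0 : ∀ᵐ x ∂ν, Tendsto (fun n => F n x) atTop (𝓝 0)) :
    Tendsto (fun n => ∫⁻ x, F n x ∂ν) atTop (𝓝 0) := by
  -- The truncation min(F, H) is dominated by H, and F ≤ R + min(F, H).
  have h1 : Tendsto (fun n => ∫⁻ x, min (F n x) (H x) ∂ν) atTop (𝓝 0) := by
    have h2 := tendsto_lintegral_of_dominated_convergence' (μ := ν) (f := fun _ => 0) H
      (fun n => (hF n).min hHm) (fun n => Eventually.of_forall fun x => min_le_right _ _) hH
      (by
        filter_upwards [hF0] with x hx
        exact tendsto_of_tendsto_of_tendsto_of_le_of_le tendsto_const_nhds hx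
          (fun n => zero_le) (fun n => min_le_left _ _))
    simpa using h2
  have h3 := hR0.add h1
  rw [add_zero] at h3
  refine tendsto_of_tendsto_of_tendsto_of_le_of_le tendsto_const_nhds h3 (fun n => zero_le)
    fun n => ?_
  simp only
  rw [← lintegral_add_left' (hR n)]
  refine lintegral_mono_ae ?_
  filter_upwards [hle n] with x hx
  rcases le_total (F n x) (H x) with h | h
  · rw [min_eq_left h]; exact le_add_self
  · rw [min_eq_right h]; exact hx

theorem enorm_rpow_le_of_growth {m : ℕ} {K a : ℝ} (hK : 0 ≤ K) (ha : 1 ≤ a) {μ s : Fin m → ℝ}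
    {y : ℝ} (hy : |y| ≤ K * ∑ i, |s i| ^ μ i) (hμ : ∀ i, 0 ≤ μ i) :
    ‖y‖ₑ ^ a ≤ ENNReal.ofReal K ^ a * ((m : ℝ≥0∞) ^ (a - 1) * ∑ i, ‖s i‖ₑ ^ (μ i * a)) := by
  have h0 : ∀ i, ENNReal.ofReal (|s i| ^ μ i) = ‖s i‖ₑ ^ μ i := fun i => by
    rw [← ENNReal.ofReal_rpow_of_nonneg (abs_nonneg _) (hμ i), ← Real.enorm_eq_ofReal_abs]
  have h1 : ‖y‖ₑ ≤ ENNReal.ofReal K * ∑ i, ‖s i‖ₑ ^ μ i := by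
    rw [Real.enorm_eq_ofReal_abs]
    refine (ENNReal.ofReal_le_ofReal hy).trans ?_
    rw [ENNReal.ofReal_mul hK, ENNReal.ofReal_sum_of_nonneg fun i _ => by positivity]
    simp only [h0, le_refl]
  have ha0 : 0 ≤ a := by linarith
  calc ‖y‖ₑ ^ a ≤ (ENNReal.ofReal K * ∑ i, ‖s i‖ₑ ^ μ i) ^ a := by gcongr
    _ = ENNReal.ofReal K ^ a * (∑ i, ‖s i‖ₑ ^ μ i) ^ a := ENNReal.mul_rpow_of_nonneg _ _ ha0
    _ ≤ _ := by
      gcongr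
      refine (ENNReal.rpow_sum_le_const_mul_sum_rpow _ _ ha).trans ?_
      simp [← ENNReal.rpow_mul]

theorem enorm_sub_rpow_le {a : ℝ} (ha : 1 ≤ a) (x y : ℝ) :
    ‖x - y‖ₑ ^ a ≤ 2 ^ (a - 1) * (‖x‖ₑ ^ a + ‖y‖ₑ ^ a) :=
  (ENNReal.rpow_le_rpow enorm_sub_le (by linarith)).trans
    (ENNReal.rpow_add_le_mul_rpow_add_rpow _ _ ha)

theorem enorm_rpow_le_sub {a : ℝ} (ha : 1 ≤ a) (x y : ℝ) :
    ‖x‖ₑ ^ a ≤ 2 ^ (a - 1) * (‖x - y‖ₑ ^ a + ‖y‖ₑ ^ a) := by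
  refine (ENNReal.rpow_le_rpow ?_ (by linarith)).trans
    (ENNReal.rpow_add_le_mul_rpow_add_rpow _ _ ha)
  simpa using enorm_add_le (x - y) y

section Nemytskii

variable {N m : ℕ} {G : (Fin m → ℝ) → ℝ} {K a : ℝ} {μ : Fin m → ℝ}

theorem lintegral_compG_rpow_lt_top (hK : 0 ≤ K) (ha : 1 ≤ a) (hμ : ∀ i, 0 ≤ μ i)
    {U : Fin m → RN N → ℝ} (hUm : ∀ i, AEStronglyMeasurable (U i) volume)
    (hg : ∀ᵐ x, |compG G U x| ≤ K * ∑ i, |U i x| ^ μ i)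
    (hU : ∀ i, ∫⁻ x, ‖U i x‖ₑ ^ (μ i * a) < ∞) : ∫⁻ x, ‖compG G U x‖ₑ ^ a < ∞ := by
  calc ∫⁻ x, ‖compG G U x‖ₑ ^ a
      ≤ ∫⁻ x, ENNReal.ofReal K ^ a * ((m : ℝ≥0∞) ^ (a - 1) * ∑ i, ‖U i x‖ₑ ^ (μ i * a)) := by
        refine lintegral_mono_ae ?_
        filter_upwards [hg] with x hx
        exact enorm_rpow_le_of_growth hK ha hx hμ
    _ = ENNReal.ofReal K ^ a * ((m : ℝ≥0∞) ^ (a - 1) * ∑ i, ∫⁻ x, ‖U i x‖ₑ ^ (μ i * a)) := by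
        rw [lintegral_const_mul', lintegral_const_mul', lintegral_finsetSum']
        · exact fun i _ => (hUm i).enorm.pow_const _
        · exact ENNReal.rpow_ne_top_of_nonneg (by linarith) (ENNReal.natCast_ne_top m)
        · exact ENNReal.rpow_ne_top_of_nonneg (by linarith) ENNReal.ofReal_ne_top
    _ < ∞ := by
        refine ENNReal.mul_lt_top (ENNReal.rpow_lt_top_of_nonneg (by linarith)
          ENNReal.ofReal_ne_top) (ENNReal.mul_lt_top (ENNReal.rpow_lt_top_of_nonneg (by linarith)
            (ENNReal.natCast_ne_top m)) ?_)
        exact ENNReal.sum_lt_top.2 fun i _ => hU i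

theorem aestronglyMeasurable_compG (hG : Continuous G) {U : Fin m → RN N → ℝ}
    (hUm : ∀ i, AEStronglyMeasurable (U i) volume) : AEStronglyMeasurable (compG G U) volume :=
  hG.comp_aestronglyMeasurable
    (aemeasurable_pi_lambda _ fun i => (hUm i).aemeasurable).aestronglyMeasurable

/-- Continuity of the superposition operator `U ↦ G(U)` along a.e. convergent sequences. -/
theorem tendsto_lintegral_compG_sub (hG : Continuous G) (hK : 0 ≤ K) (ha : 1 ≤ a)
    (hμ : ∀ i, 0 ≤ μ i) (hμa : ∀ i, 1 ≤ μ i * a) {U : ℕ → Fin m → RN N → ℝ}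
    {U' : Fin m → RN N → ℝ} (hUm : ∀ n i, AEStronglyMeasurable (U n i) volume)
    (hUm' : ∀ i, AEStronglyMeasurable (U' i) volume)
    (hg : ∀ n, ∀ᵐ x, |compG G (U n) x| ≤ K * ∑ i, |U n i x| ^ μ i)
    (hg' : ∀ᵐ x, |compG G U' x| ≤ K * ∑ i, |U' i x| ^ μ i)
    (hae : ∀ i, ∀ᵐ x, Tendsto (fun n => U n i x) atTop (𝓝 (U' i x)))
    (hU' : ∀ i, ∫⁻ x, ‖U' i x‖ₑ ^ (μ i * a) < ∞)
    (hlim : ∀ i, Tendsto (fun n => ∫⁻ x, ‖U n i x - U' i x‖ₑ ^ (μ i * a)) atTop (𝓝 0)) :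
    Tendsto (fun n => ∫⁻ x, ‖compG G (U n) x - compG G U' x‖ₑ ^ a) atTop (𝓝 0) := by
  set c : ℝ≥0∞ := 2 ^ (a - 1) * (ENNReal.ofReal K ^ a * (m : ℝ≥0∞) ^ (a - 1)) with hc
  have hctop : c ≠ ∞ := by
    refine ENNReal.mul_ne_top (ENNReal.rpow_ne_top_of_nonneg (by linarith) (by simp))
      (ENNReal.mul_ne_top (ENNReal.rpow_ne_top_of_nonneg (by linarith) ENNReal.ofReal_ne_top)
        (ENNReal.rpow_ne_top_of_nonneg (by linarith) (ENNReal.natCast_ne_top m)))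
  let d : Fin m → ℝ≥0∞ := fun i => 2 ^ (μ i * a - 1)
  have hdtop : ∀ i, d i ≠ ∞ := fun i =>
    ENNReal.rpow_ne_top_of_nonneg (by linarith [hμa i]) (by simp)
  have hdm : ∀ n i, AEMeasurable (fun x => ‖U n i x - U' i x‖ₑ ^ (μ i * a)) volume := fun n i =>
    (((hUm n i).sub (hUm' i)).enorm).pow_const _
  have hm' : ∀ i, AEMeasurable (fun x => ‖U' i x‖ₑ ^ (μ i * a)) volume := fun i =>
    (hUm' i).enorm.pow_const _
  -- By convexity |U_n|^{μ a} is controlled by |U_n - U'|^{μ a} and |U'|^{μ a}. The first has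
  -- vanishing integral and the second is a fixed integrable function, so no dominating function for
  -- the sequence itself is required.
  refine tendsto_lintegral_zero_of_le_add
    (R := fun n x => c * ∑ i, d i * ‖U n i x - U' i x‖ₑ ^ (μ i * a))
    (H := fun x => c * ∑ i, (d i * ‖U' i x‖ₑ ^ (μ i * a) + ‖U' i x‖ₑ ^ (μ i * a)))
    (fun n => (((aestronglyMeasurable_compG hG (hUm n)).sub
      (aestronglyMeasurable_compG hG hUm')).enorm).pow_const _)
    (fun n => (Finset.univ.aemeasurable_fun_sum fun i _ => (hdm n i).const_mul _).const_mul _)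
    ((Finset.univ.aemeasurable_fun_sum fun i _ => ((hm' i).const_mul _).add (hm' i)).const_mul _)
    ?_ ?_ ?_ ?_
  · intro n
    filter_upwards [hg n, hg'] with x hx hx'
    refine (enorm_sub_rpow_le ha _ _).trans ?_
    rw [← mul_add, ← Finset.sum_add_distrib]
    calc _ ≤ 2 ^ (a - 1) * (ENNReal.ofReal K ^ a * ((m : ℝ≥0∞) ^ (a - 1) *
            ∑ i, ‖U n i x‖ₑ ^ (μ i * a)) + ENNReal.ofReal K ^ a * ((m : ℝ≥0∞) ^ (a - 1) *
            ∑ i, ‖U' i x‖ₑ ^ (μ i * a))) := by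
          gcongr
          · exact enorm_rpow_le_of_growth hK ha hx hμ
          · exact enorm_rpow_le_of_growth hK ha hx' hμ
      _ = c * ∑ i, (‖U n i x‖ₑ ^ (μ i * a) + ‖U' i x‖ₑ ^ (μ i * a)) := by
          rw [Finset.sum_add_distrib, hc]; ring
      _ ≤ _ := by
          gcongr c * ?_
          refine Finset.sum_le_sum fun i _ => ?_
          refine (add_le_add_left (enorm_rpow_le_sub (hμa i) (U n i x) (U' i x)) _).trans
            (le_of_eq ?_)
          simp only [d]; ring
  · rw [lintegral_const_mul' _ _ hctop]
    refine (ENNReal.mul_lt_top hctop.lt_top ?_).ne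
    rw [lintegral_finsetSum' _ fun i _ => ((hm' i).const_mul _).fun_add (hm' i)]
    refine ENNReal.sum_lt_top.2 fun i _ => ?_
    rw [lintegral_add_right' _ (hm' i), lintegral_const_mul' _ _ (hdtop i)]
    exact ENNReal.add_lt_top.2 ⟨ENNReal.mul_lt_top (hdtop i).lt_top (hU' i), hU' i⟩
  · have h1 : ∀ n, ∫⁻ x, c * ∑ i, d i * ‖U n i x - U' i x‖ₑ ^ (μ i * a) =
        c * ∑ i, d i * ∫⁻ x, ‖U n i x - U' i x‖ₑ ^ (μ i * a) := by
      intro n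
      rw [lintegral_const_mul' _ _ hctop, lintegral_finsetSum' _ fun i _ => (hdm n i).const_mul _]
      congr 2
      ext i
      rw [lintegral_const_mul' _ _ (hdtop i)]
    simp only [h1]
    have h2 : Tendsto (fun n => c * ∑ i, d i * ∫⁻ x, ‖U n i x - U' i x‖ₑ ^ (μ i * a)) atTop
        (𝓝 (c * ∑ i : Fin m, d i * 0)) :=
      ENNReal.Tendsto.const_mul (tendsto_finsetSum _ fun i _ =>
        ENNReal.Tendsto.const_mul (hlim i) (Or.inr (hdtop i))) (Or.inr hctop)
    simpa using h2
  · filter_upwards [ae_all_iff.2 hae] with x hx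
    have h1 : Tendsto (fun n => compG G (U n) x - compG G U' x) atTop (𝓝 0) := by
      have h2 := (hG.tendsto fun i => U' i x).comp (tendsto_pi_nhds.2 hx)
      simpa [compG, Function.comp_def] using h2.sub_const (G fun i => U' i x)
    have h3 := (ENNReal.continuous_rpow_const (y := a)).tendsto _ |>.comp h1.enorm
    have ha0 : 0 < a := by linarith
    simpa [Function.comp_def, ENNReal.zero_rpow_of_pos ha0] using h3

end Nemytskii

/-! ### The quadratic convolution form -/

/-- `v` satisfies a Young inequality `∫ f (|v| * g) ≤ C (‖f‖_{a₁} ‖g‖_{a₁} + ‖f‖_{a₂} ‖g‖_{a₂})`. -/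
def IsYoungKernel {N : ℕ} (v : RN N → ℝ) (a₁ a₂ : ℝ) : Prop :=
  AEStronglyMeasurable v volume ∧ ∃ C : ℝ≥0∞, C < ∞ ∧
    ∀ f g : RN N → ℝ≥0∞, AEMeasurable f volume → AEMeasurable g volume →
      ∫⁻ x, f x * ∫⁻ t, ‖v t‖ₑ * g (x - t) ≤
        C * ((∫⁻ x, f x ^ a₁) ^ (1 / a₁) * (∫⁻ x, g x ^ a₁) ^ (1 / a₁) +
          (∫⁻ x, f x ^ a₂) ^ (1 / a₂) * (∫⁻ x, g x ^ a₂) ^ (1 / a₂))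

theorem MemWeakLp.isYoungKernel {N : ℕ} {v : RN N → ℝ} {q b₁ b₂ : ℝ} (hv : MemWeakLp v q)
    (hv0 : ∀ x, 0 ≤ v x) (hb₁ : 1 < b₁) (h1 : b₁ < q) (h2 : q < b₂) :
    IsYoungKernel v (2 * b₁ / (2 * b₁ - 1)) (2 * b₂ / (2 * b₂ - 1)) := by
  refine ⟨hv.1, ?_⟩
  simpa only [one_div_div, Real.enorm_of_nonneg (hv0 _)] using
    hv.exists_young_bound hv0 hb₁ h1 h2

section Kernel

variable {N : ℕ} {v f g : RN N → ℝ} {a₁ a₂ : ℝ}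

theorem IsYoungKernel.lintegral_lt_top (hv : IsYoungKernel v a₁ a₂) (h₁ : 0 < a₁) (h₂ : 0 < a₂)
    {f g : RN N → ℝ≥0∞} (hf : AEMeasurable f volume) (hg : AEMeasurable g volume)
    (hf₁ : ∫⁻ x, f x ^ a₁ < ∞) (hf₂ : ∫⁻ x, f x ^ a₂ < ∞)
    (hg₁ : ∫⁻ x, g x ^ a₁ < ∞) (hg₂ : ∫⁻ x, g x ^ a₂ < ∞) :
    ∫⁻ x, f x * ∫⁻ t, ‖v t‖ₑ * g (x - t) < ∞ := by
  obtain ⟨-, C, hC, h⟩ := hv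
  refine (h f g hf hg).trans_lt (ENNReal.mul_lt_top hC (ENNReal.add_lt_top.2 ⟨?_, ?_⟩)) <;>
  exact ENNReal.mul_lt_top (ENNReal.rpow_lt_top_of_nonneg (by positivity) (by finiteness))
    (ENNReal.rpow_lt_top_of_nonneg (by positivity) (by finiteness))

/-- Testing the Young inequality with the indicator of a ball shows that |v| * |g| is integrable on
every ball, hence finite almost everywhere. -/
theorem IsYoungKernel.ae_convolutionExistsAt (hv : IsYoungKernel v a₁ a₂) (h₁ : 0 < a₁)
    (h₂ : 0 < a₂) (hg : AEStronglyMeasurable g volume)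
    (hg₁ : ∫⁻ x, ‖g x‖ₑ ^ a₁ < ∞) (hg₂ : ∫⁻ x, ‖g x‖ₑ ^ a₂ < ∞) :
    ∀ᵐ x, ConvolutionExistsAt v g x (ContinuousLinearMap.mul ℝ ℝ) volume := by
  have hm : AEMeasurable (fun x => ∫⁻ t, ‖v t‖ₑ * ‖g (x - t)‖ₑ) volume :=
    (hv.1.enorm.comp_snd.mul (hg.enorm.comp_quasiMeasurePreserving
      (quasiMeasurePreserving_sub_of_right_invariant volume volume))).lintegral_prod_right'
  have hball : ∀ n : ℕ, ∀ᵐ x, x ∈ Metric.ball (0 : RN N) n →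
      ∫⁻ t, ‖v t‖ₑ * ‖g (x - t)‖ₑ < ∞ := by
    intro n
    have hind : ∀ a : ℝ, 0 < a →
        ∫⁻ x, ((Metric.ball (0 : RN N) n).indicator (fun _ => (1 : ℝ≥0∞)) x) ^ a < ∞ := by
      intro a ha
      have : ∀ x, ((Metric.ball (0 : RN N) n).indicator (fun _ => (1 : ℝ≥0∞)) x) ^ a =
          (Metric.ball (0 : RN N) n).indicator (fun _ => (1 : ℝ≥0∞)) x := by
        intro x
        by_cases hx : x ∈ Metric.ball (0 : RN N) n <;> simp [hx, ha]
      simp only [this]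
      rw [lintegral_indicator Metric.isOpen_ball.measurableSet]
      simp [measure_ball_lt_top]
    have h := hv.lintegral_lt_top h₁ h₂ (g := fun x => ‖g x‖ₑ)
      ((measurable_const.indicator Metric.isOpen_ball.measurableSet).aemeasurable) hg.enorm
      (hind a₁ h₁) (hind a₂ h₂) hg₁ hg₂
    have h' : ∫⁻ x in Metric.ball (0 : RN N) n, ∫⁻ t, ‖v t‖ₑ * ‖g (x - t)‖ₑ < ∞ := by
      rw [← lintegral_indicator Metric.isOpen_ball.measurableSet]
      refine lt_of_le_of_lt (lintegral_mono fun x => ?_) h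
      by_cases hx : x ∈ Metric.ball (0 : RN N) n <;> simp [hx]
    exact (ae_restrict_iff' Metric.isOpen_ball.measurableSet).1 (ae_lt_top' hm.restrict h'.ne)
  filter_upwards [ae_all_iff.2 hball] with x hx
  obtain ⟨n, hn⟩ := exists_nat_gt ‖x‖
  have hfin := hx n (by simpa using hn)
  refine ⟨hv.1.convolution_integrand_snd _ hg x, ?_⟩
  rw [hasFiniteIntegral_iff_enorm]
  simpa [enorm_mul] using hfin

theorem enorm_convolution_le (v g : RN N → ℝ) (x : RN N) :
    ‖(v ⋆[ContinuousLinearMap.mul ℝ ℝ, volume] g) x‖ₑ ≤ ∫⁻ t, ‖v t‖ₑ * ‖g (x - t)‖ₑ := by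
  rw [convolution_def]
  refine (enorm_integral_le_lintegral_enorm _).trans (le_of_eq ?_)
  simp [enorm_mul]

theorem aestronglyMeasurable_mul_convolution (hv : AEStronglyMeasurable v volume)
    (hg : AEStronglyMeasurable g volume) :
    AEStronglyMeasurable
      (fun x => g x * (v ⋆[ContinuousLinearMap.mul ℝ ℝ, volume] g) x) volume :=
  hg.mul (hv.convolution_integrand (ContinuousLinearMap.mul ℝ ℝ) hg).integral_prod_right'

theorem IsYoungKernel.integrable_mul_convolution (hv : IsYoungKernel v a₁ a₂) (h₁ : 0 < a₁)
    (h₂ : 0 < a₂) (hg : AEStronglyMeasurable g volume)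
    (hg₁ : ∫⁻ x, ‖g x‖ₑ ^ a₁ < ∞) (hg₂ : ∫⁻ x, ‖g x‖ₑ ^ a₂ < ∞) :
    Integrable (fun x => g x * (v ⋆[ContinuousLinearMap.mul ℝ ℝ, volume] g) x) volume := by
  refine ⟨aestronglyMeasurable_mul_convolution hv.1 hg, ?_⟩
  rw [hasFiniteIntegral_iff_enorm]
  refine lt_of_le_of_lt (lintegral_mono fun x => ?_)
    (hv.lintegral_lt_top h₁ h₂ hg.enorm hg.enorm hg₁ hg₂ hg₁ hg₂)
  rw [enorm_mul]
  gcongr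
  exact enorm_convolution_le v g x

/-- Expanding the quadratic form at g gives two terms linear in f - g and one quadratic term. The
right side involves f only through f - g, so no separate bound on f is needed when f → g. -/
theorem IsYoungKernel.lintegral_sub_le (hv : IsYoungKernel v a₁ a₂) (h₁ : 0 < a₁)
    (h₂ : 0 < a₂) (hf : AEStronglyMeasurable f volume) (hg : AEStronglyMeasurable g volume)
    (hf₁ : ∫⁻ x, ‖f x‖ₑ ^ a₁ < ∞) (hf₂ : ∫⁻ x, ‖f x‖ₑ ^ a₂ < ∞)
    (hg₁ : ∫⁻ x, ‖g x‖ₑ ^ a₁ < ∞) (hg₂ : ∫⁻ x, ‖g x‖ₑ ^ a₂ < ∞) :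
    ∫⁻ x, ‖f x * (v ⋆[ContinuousLinearMap.mul ℝ ℝ, volume] f) x -
        g x * (v ⋆[ContinuousLinearMap.mul ℝ ℝ, volume] g) x‖ₑ ≤
      (∫⁻ x, ‖f x - g x‖ₑ * ∫⁻ t, ‖v t‖ₑ * ‖g (x - t)‖ₑ) +
      (∫⁻ x, ‖g x‖ₑ * ∫⁻ t, ‖v t‖ₑ * ‖f (x - t) - g (x - t)‖ₑ) +
      ∫⁻ x, ‖f x - g x‖ₑ * ∫⁻ t, ‖v t‖ₑ * ‖f (x - t) - g (x - t)‖ₑ := by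
  have hd : AEStronglyMeasurable (f - g) volume := hf.sub hg
  have hmc : ∀ {k : RN N → ℝ}, AEStronglyMeasurable k volume →
      AEMeasurable (fun x => ∫⁻ t, ‖v t‖ₑ * ‖k (x - t)‖ₑ) volume := fun hk =>
    (hv.1.enorm.comp_snd.mul (hk.enorm.comp_quasiMeasurePreserving
      (quasiMeasurePreserving_sub_of_right_invariant volume volume))).lintegral_prod_right'
  have hA : AEMeasurable (fun x => ‖f x - g x‖ₑ * ∫⁻ t, ‖v t‖ₑ * ‖g (x - t)‖ₑ) volume :=
    hd.enorm.mul (hmc hg)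
  have hB : AEMeasurable
      (fun x => ‖g x‖ₑ * ∫⁻ t, ‖v t‖ₑ * ‖f (x - t) - g (x - t)‖ₑ) volume :=
    hg.enorm.mul (hmc hd)
  rw [← lintegral_add_left' hA, ← lintegral_add_left' (hA.fun_add hB)]
  refine lintegral_mono_ae ?_
  filter_upwards [hv.ae_convolutionExistsAt h₁ h₂ hf hf₁ hf₂,
    hv.ae_convolutionExistsAt h₁ h₂ hg hg₁ hg₂] with x hxf hxg
  set cf := (v ⋆[ContinuousLinearMap.mul ℝ ℝ, volume] f) x with hcf
  set cg := (v ⋆[ContinuousLinearMap.mul ℝ ℝ, volume] g) x with hcg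
  have hsub : cf - cg = (v ⋆[ContinuousLinearMap.mul ℝ ℝ, volume] (f - g)) x := by
    rw [hcf, hcg, convolution_def, convolution_def, convolution_def, ← integral_sub hxf hxg]
    simp [mul_sub]
  have h3 : ‖cf - cg‖ₑ ≤ ∫⁻ t, ‖v t‖ₑ * ‖f (x - t) - g (x - t)‖ₑ := by
    rw [hsub]; exact enorm_convolution_le v (f - g) x
  have h4 : ‖cg‖ₑ ≤ ∫⁻ t, ‖v t‖ₑ * ‖g (x - t)‖ₑ := enorm_convolution_le v g x
  have h5 : f x * cf - g x * cg =
      (f x - g x) * cg + g x * (cf - cg) + (f x - g x) * (cf - cg) := by ring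
  rw [h5]
  refine (enorm_add_le _ _).trans (add_le_add ((enorm_add_le _ _).trans (add_le_add ?_ ?_)) ?_) <;>
  · rw [enorm_mul]; gcongr

theorem IsYoungKernel.tendsto_lintegral_sub (hv : IsYoungKernel v a₁ a₂) (h₁ : 0 < a₁)
    (h₂ : 0 < a₂) {f : ℕ → RN N → ℝ} (hf : ∀ n, AEStronglyMeasurable (f n) volume)
    (hg : AEStronglyMeasurable g volume)
    (hf₁ : ∀ n, ∫⁻ x, ‖f n x‖ₑ ^ a₁ < ∞) (hf₂ : ∀ n, ∫⁻ x, ‖f n x‖ₑ ^ a₂ < ∞)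
    (hg₁ : ∫⁻ x, ‖g x‖ₑ ^ a₁ < ∞) (hg₂ : ∫⁻ x, ‖g x‖ₑ ^ a₂ < ∞)
    (hl₁ : Tendsto (fun n => ∫⁻ x, ‖f n x - g x‖ₑ ^ a₁) atTop (𝓝 0))
    (hl₂ : Tendsto (fun n => ∫⁻ x, ‖f n x - g x‖ₑ ^ a₂) atTop (𝓝 0)) :
    Tendsto (fun n => ∫⁻ x, ‖f n x * (v ⋆[ContinuousLinearMap.mul ℝ ℝ, volume] (f n)) x -
        g x * (v ⋆[ContinuousLinearMap.mul ℝ ℝ, volume] g) x‖ₑ) atTop (𝓝 0) := by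
  obtain ⟨C, hC, hY⟩ := hv.2
  have hpow : ∀ a : ℝ, 0 < a → ∀ F : ℕ → ℝ≥0∞, Tendsto F atTop (𝓝 0) →
      Tendsto (fun n => F n ^ (1 / a)) atTop (𝓝 0) := by
    intro a ha F hF
    have := ((ENNReal.continuous_rpow_const (y := 1 / a)).tendsto 0).comp hF
    rwa [ENNReal.zero_rpow_of_pos (by positivity)] at this
  have t₁ := hpow a₁ h₁ _ hl₁
  have t₂ := hpow a₂ h₂ _ hl₂
  have g₁ : (∫⁻ x, ‖g x‖ₑ ^ a₁) ^ (1 / a₁) ≠ ∞ :=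
    ENNReal.rpow_ne_top_of_nonneg (by positivity) hg₁.ne
  have g₂ : (∫⁻ x, ‖g x‖ₑ ^ a₂) ^ (1 / a₂) ≠ ∞ :=
    ENNReal.rpow_ne_top_of_nonneg (by positivity) hg₂.ne
  have hsq : ∀ F : ℕ → ℝ≥0∞, Tendsto F atTop (𝓝 0) →
      Tendsto (fun n => F n * F n) atTop (𝓝 0) := fun F hF => by
    simpa using ENNReal.Tendsto.mul hF (Or.inr ENNReal.zero_ne_top) hF
      (Or.inr ENNReal.zero_ne_top)
  have hbound := ((ENNReal.Tendsto.const_mul (((ENNReal.Tendsto.mul_const t₁ (Or.inr g₁)).add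
      (ENNReal.Tendsto.mul_const t₂ (Or.inr g₂)))) (Or.inr hC.ne)).add
    (ENNReal.Tendsto.const_mul (((ENNReal.Tendsto.const_mul t₁ (Or.inr g₁)).add
      (ENNReal.Tendsto.const_mul t₂ (Or.inr g₂)))) (Or.inr hC.ne))).add
    (ENNReal.Tendsto.const_mul ((hsq _ t₁).add (hsq _ t₂)) (Or.inr hC.ne))
  simp only [zero_mul, mul_zero, add_zero] at hbound
  refine tendsto_of_tendsto_of_tendsto_of_le_of_le tendsto_const_nhds hbound (fun n => zero_le)
    fun n => ?_
  have hd : AEMeasurable (fun x => ‖f n x - g x‖ₑ) volume := ((hf n).sub hg).enorm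
  refine (hv.lintegral_sub_le h₁ h₂ (hf n) hg (hf₁ n) (hf₂ n) hg₁ hg₂).trans ?_
  exact add_le_add (add_le_add (hY _ _ hd hg.enorm) (hY (fun x => ‖g x‖ₑ) _ hg.enorm hd))
    (hY _ _ hd hd)

end Kernel

/-! ### Choice of exponents and sequential continuity of the nonlocal term -/

/-- The admissible nonlinearities, with the two auxiliary integrability exponents `a₁`, `a₂` of
`G(U)` for which the kernel satisfies a Young inequality. -/
structure IsAdmissible {N m : ℕ} (G : (Fin m → ℝ) → ℝ) (v : RN N → ℝ) (K p r : ℝ)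
    (μ : Fin m → ℝ) (a₁ a₂ : ℝ) : Prop where
  cont : Continuous G
  nonneg : 0 ≤ K
  one_lt : 1 < p
  one_le₁ : 1 ≤ a₁
  one_le₂ : 1 ≤ a₂
  pos : ∀ i, 0 < μ i
  kernel : IsYoungKernel v a₁ a₂
  mem₁ : ∀ i, μ i * a₁ ∈ Ioo p r
  mem₂ : ∀ i, μ i * a₂ ∈ Ioo p r

/-- At b = q the two bounds on μ_i say exactly that μ_i · 2b/(2b-1) lies in (p, r). This is an open
condition on b and there are finitely many i, so it persists for some b₁ < q and some b₂ > q. -/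
theorem exists_isAdmissible {N m : ℕ} {G : (Fin m → ℝ) → ℝ} {v : RN N → ℝ} {K p r q : ℝ}
    {μ : Fin m → ℝ} (hG : Continuous G) (hK : 0 ≤ K) (hp : 1 < p) (hq : 1 < q)
    (hv : MemWeakLp v q) (hv0 : ∀ x, 0 ≤ v x)
    (h1 : ∀ i, p * ((2 * q - 1) / (2 * q)) < μ i) (h2 : ∀ i, μ i < r * ((2 * q - 1) / (2 * q))) :
    ∃ a₁ a₂, IsAdmissible G v K p r μ a₁ a₂ := by
  have hq0 : 0 < 2 * q - 1 := by linarith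
  have hev : ∀ᶠ b in 𝓝 q, 1 < b ∧ ∀ i, μ i * (2 * b / (2 * b - 1)) ∈ Ioo p r := by
    refine (eventually_gt_nhds hq).and (eventually_all.2 fun i => ?_)
    have hc : ContinuousAt (fun b : ℝ => μ i * (2 * b / (2 * b - 1))) q := by
      refine continuousAt_const.mul (ContinuousAt.div (by fun_prop) (by fun_prop) hq0.ne')
    refine hc.eventually_mem (Ioo_mem_nhds ?_ ?_)
    · have := h1 i
      rw [mul_div_assoc', div_lt_iff₀ (by linarith)] at this
      rw [mul_div_assoc', lt_div_iff₀ hq0]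
      linarith
    · have := h2 i
      rw [mul_div_assoc', lt_div_iff₀ (by linarith)] at this
      rw [mul_div_assoc', div_lt_iff₀ hq0]
      linarith
  obtain ⟨b₁, ⟨hb₁, hm₁⟩, hlt₁⟩ := ((hev.filter_mono (nhdsWithin_le_nhds (s := Iio q))).and
    self_mem_nhdsWithin).exists
  obtain ⟨b₂, ⟨hb₂, hm₂⟩, hlt₂⟩ := ((hev.filter_mono (nhdsWithin_le_nhds (s := Ioi q))).and
    self_mem_nhdsWithin).exists
  have hone : ∀ b : ℝ, 1 < b → 1 ≤ 2 * b / (2 * b - 1) := fun b hb => by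
    rw [le_div_iff₀ (by linarith)]; linarith
  exact ⟨_, _, hG, hK, hp, hone b₁ hb₁, hone b₂ hb₂,
    fun i => lt_trans (by have := hq0; positivity) (h1 i),
    hv.isYoungKernel hv0 hb₁ hlt₁ hlt₂, hm₁, hm₂⟩

/-- Measurability, growth of `G(U)` and integrability of the components in the open range of
exponents between `p` and `r`. -/
structure IsGood {N m : ℕ} (G : (Fin m → ℝ) → ℝ) (K p r : ℝ) (μ : Fin m → ℝ)
    (U : Fin m → RN N → ℝ) : Prop where
  meas : ∀ i, AEStronglyMeasurable (U i) volume
  growth : ∀ᵐ x, |compG G U x| ≤ K * ∑ i, |U i x| ^ μ i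
  int : ∀ i, ∀ s ∈ Ioo p r, ∫⁻ x, ‖U i x‖ₑ ^ s < ∞

section

variable {N m : ℕ} {G : (Fin m → ℝ) → ℝ} {V : ℝ → ℝ} {K p r a₁ a₂ : ℝ} {μ : Fin m → ℝ}

theorem IsAdmissible.lintegral_compG_lt_top {v : RN N → ℝ} (h : IsAdmissible G v K p r μ a₁ a₂)
    {U : Fin m → RN N → ℝ} (hU : IsGood G K p r μ U) :
    ∫⁻ x, ‖compG G U x‖ₑ ^ a₁ < ∞ ∧ ∫⁻ x, ‖compG G U x‖ₑ ^ a₂ < ∞ :=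
  ⟨lintegral_compG_rpow_lt_top h.nonneg h.one_le₁ (fun i => (h.pos i).le) hU.meas hU.growth
    fun i => hU.int i _ (h.mem₁ i),
   lintegral_compG_rpow_lt_top h.nonneg h.one_le₂ (fun i => (h.pos i).le) hU.meas hU.growth
    fun i => hU.int i _ (h.mem₂ i)⟩

theorem IsAdmissible.exists_isNonlocalTerm
    (h : IsAdmissible G (fun x : RN N => V ‖x‖) K p r μ a₁ a₂) {U : Fin m → RN N → ℝ}
    (hU : IsGood G K p r μ U) :
    ∃ w : Lp ℝ 1 (volume : Measure (RN N)), IsNonlocalTerm G V U w := by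
  have h₁ : 0 < a₁ := zero_lt_one.trans_le h.one_le₁
  have h₂ : 0 < a₂ := zero_lt_one.trans_le h.one_le₂
  have hm := aestronglyMeasurable_compG h.cont hU.meas
  obtain ⟨i₁, i₂⟩ := h.lintegral_compG_lt_top hU
  exact ⟨(h.kernel.integrable_mul_convolution h₁ h₂ hm i₁ i₂).toL1 _,
    h.kernel.ae_convolutionExistsAt h₁ h₂ hm i₁ i₂, Integrable.coeFn_toL1 _⟩

/-- Sequential continuity of the nonlocal term. -/
theorem IsAdmissible.tendsto_of_isNonlocalTerm
    (h : IsAdmissible G (fun x : RN N => V ‖x‖) K p r μ a₁ a₂)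
    {U : ℕ → Fin m → RN N → ℝ} {U' : Fin m → RN N → ℝ} (hU : ∀ n, IsGood G K p r μ (U n))
    (hU' : IsGood G K p r μ U')
    (hae : ∀ i, ∀ᵐ x, Tendsto (fun n => U n i x) atTop (𝓝 (U' i x)))
    (hlim : ∀ i, ∀ s ∈ Ioo p r,
      Tendsto (fun n => ∫⁻ x, ‖U n i x - U' i x‖ₑ ^ s) atTop (𝓝 0))
    {w : ℕ → Lp ℝ 1 (volume : Measure (RN N))} {w' : Lp ℝ 1 (volume : Measure (RN N))}
    (hw : ∀ n, IsNonlocalTerm G V (U n) (w n)) (hw' : IsNonlocalTerm G V U' w') :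
    Tendsto w atTop (𝓝 w') := by
  have h₁ : 0 < a₁ := zero_lt_one.trans_le h.one_le₁
  have h₂ : 0 < a₂ := zero_lt_one.trans_le h.one_le₂
  rw [Lp.tendsto_Lp_iff_tendsto_eLpNorm']
  have key := h.kernel.tendsto_lintegral_sub h₁ h₂
    (fun n => aestronglyMeasurable_compG h.cont (hU n).meas)
    (aestronglyMeasurable_compG h.cont hU'.meas)
    (fun n => (h.lintegral_compG_lt_top (hU n)).1) (fun n => (h.lintegral_compG_lt_top (hU n)).2)
    (h.lintegral_compG_lt_top hU').1 (h.lintegral_compG_lt_top hU').2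
    (tendsto_lintegral_compG_sub h.cont h.nonneg h.one_le₁ (fun i => (h.pos i).le)
      (fun i => h.one_lt.le.trans (h.mem₁ i).1.le) (fun n => (hU n).meas) hU'.meas
      (fun n => (hU n).growth) hU'.growth hae (fun i => hU'.int i _ (h.mem₁ i))
      fun i => hlim i _ (h.mem₁ i))
    (tendsto_lintegral_compG_sub h.cont h.nonneg h.one_le₂ (fun i => (h.pos i).le)
      (fun i => h.one_lt.le.trans (h.mem₂ i).1.le) (fun n => (hU n).meas) hU'.meas
      (fun n => (hU n).growth) hU'.growth hae (fun i => hU'.int i _ (h.mem₂ i))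
      fun i => hlim i _ (h.mem₂ i))
  refine key.congr fun n => ?_
  rw [eLpNorm_one_eq_lintegral_enorm]
  refine lintegral_congr_ae ?_
  filter_upwards [(hw n).2, hw'.2] with x hx hx'
  rw [Pi.sub_apply, hx, hx']

/-- For the compactness part: there the limit is known only as an a.e. limit, not as an element of
the domain, so its growth bound has to be inherited. Positivity of μ_i keeps t ↦ t^{μ_i} continuous
at 0. -/
theorem growth_of_tendsto (hG : Continuous G) (hμ : ∀ i, 0 < μ i) {U : ℕ → Fin m → RN N → ℝ}
    {U' : Fin m → RN N → ℝ}
    (hg : ∀ n, ∀ᵐ x, |compG G (U n) x| ≤ K * ∑ i, |U n i x| ^ μ i)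
    (hae : ∀ i, ∀ᵐ x, Tendsto (fun n => U n i x) atTop (𝓝 (U' i x))) :
    ∀ᵐ x, |compG G U' x| ≤ K * ∑ i, |U' i x| ^ μ i := by
  filter_upwards [ae_all_iff.2 hg, ae_all_iff.2 hae] with x hx hl
  have h1 := ((hG.tendsto fun i => U' i x).comp (tendsto_pi_nhds.2 hl)).abs
  refine le_of_tendsto_of_tendsto' h1 (tendsto_const_nhds.mul
    (tendsto_finsetSum _ fun i _ => ?_)) hx
  exact (hl i).abs.rpow_const (Or.inr (hμ i).le)

end

/-! ### Continuity on the intersection of two Lebesgue spaces -/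

theorem ENNReal.rpow_le_rpow_add_rpow (x : ℝ≥0∞) {p s r : ℝ} (h1 : p ≤ s) (h2 : s ≤ r) :
    x ^ s ≤ x ^ p + x ^ r := by
  rcases le_total x 1 with hx | hx
  · exact (ENNReal.rpow_le_rpow_of_exponent_ge hx h1).trans le_self_add
  · exact (ENNReal.rpow_le_rpow_of_exponent_le hx h2).trans le_add_self

section Lebesgue

variable {α E : Type*} [MeasurableSpace α] {ν : Measure α} [NormedAddCommGroup E] {p : ℝ}

theorem lintegral_rpow_eq_eLpNorm_rpow (hp : 0 < p) (f : α → E) :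
    ∫⁻ x, ‖f x‖ₑ ^ p ∂ν = eLpNorm f (ENNReal.ofReal p) ν ^ p := by
  rw [eLpNorm_eq_lintegral_rpow_enorm_toReal (by simpa using hp) ENNReal.ofReal_ne_top,
    ENNReal.toReal_ofReal hp.le, ← ENNReal.rpow_mul, one_div_mul_cancel hp.ne', ENNReal.rpow_one]

theorem Lp.lintegral_rpow_lt_top (hp : 0 < p) (f : Lp E (ENNReal.ofReal p) ν) :
    ∫⁻ x, ‖f x‖ₑ ^ p ∂ν < ∞ := by
  rw [lintegral_rpow_eq_eLpNorm_rpow hp]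
  exact ENNReal.rpow_lt_top_of_nonneg hp.le (Lp.eLpNorm_lt_top f).ne

theorem Lp.tendsto_lintegral_rpow_sub (hp : 0 < p) [Fact (1 ≤ ENNReal.ofReal p)]
    {f : ℕ → Lp E (ENNReal.ofReal p) ν} {g : Lp E (ENNReal.ofReal p) ν}
    (h : Tendsto f atTop (𝓝 g)) :
    Tendsto (fun n => ∫⁻ x, ‖f n x - g x‖ₑ ^ p ∂ν) atTop (𝓝 0) := by
  rw [Lp.tendsto_Lp_iff_tendsto_eLpNorm'] at h
  have h1 := ((ENNReal.continuous_rpow_const (y := p)).tendsto _).comp h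
  rw [ENNReal.zero_rpow_of_pos hp] at h1
  refine h1.congr fun n => ?_
  simp only [Function.comp_apply]
  rw [← lintegral_rpow_eq_eLpNorm_rpow hp]
  rfl

/-- A common a.e. convergent subsequence for finitely many sequences converging in `L^p`. -/
theorem exists_subseq_tendsto_ae_of_finite {ι : Type*} [Finite ι] (hp : 0 < p)
    {f : ℕ → ι → α → E} {g : ι → α → E} (hf : ∀ n i, AEStronglyMeasurable (f n i) ν)
    (hg : ∀ i, AEStronglyMeasurable (g i) ν)
    (h : ∀ i, Tendsto (fun n => ∫⁻ x, ‖f n i x - g i x‖ₑ ^ p ∂ν) atTop (𝓝 0)) :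
    ∃ ns : ℕ → ℕ, StrictMono ns ∧
      ∀ i, ∀ᵐ x ∂ν, Tendsto (fun n => f (ns n) i x) atTop (𝓝 (g i x)) := by
  classical
  have := Fintype.ofFinite ι
  suffices H : ∀ s : Finset ι, ∃ ns : ℕ → ℕ, StrictMono ns ∧
      ∀ i ∈ s, ∀ᵐ x ∂ν, Tendsto (fun n => f (ns n) i x) atTop (𝓝 (g i x)) by
    obtain ⟨ns, h1, h2⟩ := H Finset.univ
    exact ⟨ns, h1, fun i => h2 i (Finset.mem_univ i)⟩
  intro s
  induction s using Finset.induction_on with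
  | empty => exact ⟨id, strictMono_id, by simp⟩
  | insert j s hj ih =>
    obtain ⟨ns, h1, h2⟩ := ih
    have h3 : TendstoInMeasure ν (fun n => f (ns n) j) atTop (g j) := by
      refine tendstoInMeasure_of_tendsto_eLpNorm (p := ENNReal.ofReal p) (by simpa using hp)
        (fun n => hf _ j) (hg j) ?_
      have h4 := ((ENNReal.continuous_rpow_const (y := 1 / p)).tendsto _).comp
        ((h j).comp h1.tendsto_atTop)
      rw [ENNReal.zero_rpow_of_pos (by positivity)] at h4
      refine h4.congr fun n => ?_
      simp only [Function.comp_apply]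
      rw [eLpNorm_eq_lintegral_rpow_enorm_toReal (by simpa using hp) ENNReal.ofReal_ne_top,
        ENNReal.toReal_ofReal hp.le]
      rfl
    obtain ⟨ms, h5, h6⟩ := h3.exists_seq_tendsto_ae
    refine ⟨ns ∘ ms, h1.comp h5, fun i hi => ?_⟩
    rcases Finset.mem_insert.1 hi with rfl | hi
    · exact h6
    · filter_upwards [h2 i hi] with x hx
      exact hx.comp h5.tendsto_atTop

end Lebesgue

section

variable {N m : ℕ} {G : (Fin m → ℝ) → ℝ} {V : ℝ → ℝ} {K p r a₁ a₂ : ℝ} {μ : Fin m → ℝ}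
  [Fact (1 < p)] [Fact (1 < r)]

theorem LpInter.isGood (U : Fin m → LpInter N p r)
    (hg : ∀ᵐ x, |compG G (fun i => ((U i).1 : RN N → ℝ)) x| ≤
      K * ∑ i, |((U i).1 : RN N → ℝ) x| ^ μ i) :
    IsGood G K p r μ (fun i => ((U i).1 : RN N → ℝ)) where
  meas i := (U i).1.aestronglyMeasurable
  growth := hg
  int i s hs := by
    have hp : 0 < p := zero_lt_one.trans Fact.out
    have hr : 0 < r := zero_lt_one.trans Fact.out
    calc ∫⁻ x, ‖((U i).1 : RN N → ℝ) x‖ₑ ^ s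
        ≤ ∫⁻ x, (‖((U i).1 : RN N → ℝ) x‖ₑ ^ p + ‖((U i).1 : RN N → ℝ) x‖ₑ ^ r) :=
          lintegral_mono fun x => ENNReal.rpow_le_rpow_add_rpow _ hs.1.le hs.2.le
      _ = (∫⁻ x, ‖((U i).1 : RN N → ℝ) x‖ₑ ^ p) + ∫⁻ x, ‖((U i).1 : RN N → ℝ) x‖ₑ ^ r :=
          lintegral_add_left' ((U i).1.aestronglyMeasurable.enorm.pow_const _) _
      _ < ∞ := ENNReal.add_lt_top.2
          ⟨Lp.lintegral_rpow_lt_top hp (U i).toProd.1, Lp.lintegral_rpow_lt_top hr (U i).toProd.2⟩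

instance : FirstCountableTopology (LpInter N p r) :=
  (Topology.IsInducing.mk rfl : Topology.IsInducing (LpInter.toProd (N := N) (p := p) (r := r)))
    |>.firstCountableTopology

theorem LpInter.tendsto_lintegral_rpow_sub {u : ℕ → LpInter N p r} {u' : LpInter N p r}
    (h : Tendsto u atTop (𝓝 u')) :
    ∀ s ∈ Icc p r, Tendsto (fun n => ∫⁻ x, ‖(u n).1 x - u'.1 x‖ₑ ^ s) atTop (𝓝 0) := by
  have hp : 0 < p := zero_lt_one.trans Fact.out
  have hr : 0 < r := zero_lt_one.trans Fact.out
  have hcomp : Tendsto (fun n => (u n).toProd) atTop (𝓝 u'.toProd) :=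
    (continuous_induced_dom.tendsto _).comp h
  have hlp : Tendsto (fun n => ∫⁻ x, ‖(u n).toProd.1 x - u'.toProd.1 x‖ₑ ^ p) atTop (𝓝 0) :=
    Lp.tendsto_lintegral_rpow_sub hp ((continuous_fst.tendsto _).comp hcomp)
  have hlr : Tendsto (fun n => ∫⁻ x, ‖(u n).toProd.2 x - u'.toProd.2 x‖ₑ ^ r) atTop (𝓝 0) :=
    Lp.tendsto_lintegral_rpow_sub hr ((continuous_snd.tendsto _).comp hcomp)
  change Tendsto (fun n => ∫⁻ x, ‖(u n).1 x - u'.1 x‖ₑ ^ p) atTop (𝓝 0) at hlp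
  change Tendsto (fun n => ∫⁻ x, ‖(u n).1 x - u'.1 x‖ₑ ^ r) atTop (𝓝 0) at hlr
  intro s hs
  have hadd := hlp.add hlr
  rw [add_zero] at hadd
  refine tendsto_of_tendsto_of_tendsto_of_le_of_le tendsto_const_nhds hadd
    (fun n => zero_le) fun n => ?_
  have hm : AEMeasurable (fun x => ‖(u n).1 x - u'.1 x‖ₑ ^ p) volume :=
    ((u n).1.aestronglyMeasurable.sub u'.1.aestronglyMeasurable).enorm.pow_const _
  exact (lintegral_mono fun x => ENNReal.rpow_le_rpow_add_rpow _ hs.1 hs.2).trans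
    (lintegral_add_left' hm _).le

theorem IsAdmissible.nonlocalContinuousOn (hpr : p ≤ r)
    (h : IsAdmissible G (fun x : RN N => V ‖x‖) K p r μ a₁ a₂) {D : Set (Fin m → LpInter N p r)}
    (hD : ∀ U ∈ D, ∀ᵐ x, |compG G (fun i => ((U i).1 : RN N → ℝ)) x| ≤
      K * ∑ i, |((U i).1 : RN N → ℝ) x| ^ μ i) :
    NonlocalContinuousOn G V D := by
  have hp : 0 < p := zero_lt_one.trans Fact.out
  have hgood := fun U : D => LpInter.isGood U.1 (hD U.1 U.2)
  choose Q hQ using fun U : D => h.exists_isNonlocalTerm (hgood U)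
  -- The topology is induced from a product of normed spaces, hence first countable, and sequences
  -- suffice.
  refine ⟨Q, hQ, continuous_iff_seqContinuous.2 fun U U' hU => ?_⟩
  have hcomp : ∀ i, Tendsto (fun n => (U n).1 i) atTop (𝓝 (U'.1 i)) := fun i =>
    ((continuous_apply i).comp continuous_subtype_val).tendsto U' |>.comp hU
  have hls := fun i => LpInter.tendsto_lintegral_rpow_sub (hcomp i)
  -- Convergence in L^p gives a.e. convergence only along subsequences. This is enough, since every
  -- subsequence then has a further one along which the values tend to the same limit.
  refine tendsto_of_subseq_tendsto fun ns hns => ?_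
  obtain ⟨ms, hmono, hms⟩ := exists_subseq_tendsto_ae_of_finite hp
    (f := fun n i => (((U (ns n)).1 i).1 : RN N → ℝ)) (g := fun i => ((U'.1 i).1 : RN N → ℝ))
    (fun n i => ((U (ns n)).1 i).1.aestronglyMeasurable)
    (fun i => (U'.1 i).1.aestronglyMeasurable) (fun i => (hls i p ⟨le_rfl, hpr⟩).comp hns)
  exact ⟨ms, h.tendsto_of_isNonlocalTerm (fun n => hgood _) (hgood U') hms
    (fun i s hs => (hls i s ⟨hs.1.le, hs.2.le⟩).comp (hns.comp hmono.tendsto_atTop)) (fun n => hQ _) (hQ U')⟩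

end

/-- A sequence in the closure can be shadowed by one in S at distance below 1/(n+1), so only
sequences in S itself need to be tested. -/
theorem isCompact_closure_of_subseq {X : Type*} [PseudoMetricSpace X] {S : Set X}
    (h : ∀ x : ℕ → X, (∀ n, x n ∈ S) →
      ∃ a, ∃ φ : ℕ → ℕ, StrictMono φ ∧ Tendsto (x ∘ φ) atTop (𝓝 a)) : IsCompact (closure S) := by
  refine IsSeqCompact.isCompact fun y hy => ?_
  have hx : ∀ n : ℕ, ∃ x ∈ S, dist (y n) x < 1 / ((n : ℝ) + 1) := fun n =>
    Metric.mem_closure_iff.1 (hy n) _ Nat.one_div_pos_of_nat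
  choose x hxS hxd using hx
  obtain ⟨a, φ, hφ, hlim⟩ := h x hxS
  have h0 : Tendsto (fun n => dist (x (φ n)) (y (φ n))) atTop (𝓝 0) :=
    squeeze_zero (fun n => dist_nonneg) (fun n => by rw [dist_comm]; exact (hxd (φ n)).le)
      (tendsto_one_div_add_atTop_nhds_zero_nat.comp hφ.tendsto_atTop)
  have hya : Tendsto (y ∘ φ) atTop (𝓝 a) := (tendsto_iff_of_dist h0).1 hlim
  exact ⟨a, mem_closure_of_tendsto hya (Eventually.of_forall fun n => hy _) |> fun h => by
    simpa using h, φ, hφ, hya⟩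

/-! ### Polar coordinates -/

section Polar

variable {N : ℕ}

theorem homeomorphUnitSphereProd_smul (x : ({0}ᶜ : Set (RN N))) :
    ((homeomorphUnitSphereProd (RN N) x).2 : ℝ) • ((homeomorphUnitSphereProd (RN N) x).1 : RN N) =
      x := by
  have := homeomorphUnitSphereProd_symm_apply_coe (RN N) (homeomorphUnitSphereProd (RN N) x)
  rw [Homeomorph.symm_apply_apply] at this
  exact this.symm

variable [Nontrivial (RN N)]

/-- Integration in polar coordinates. -/
theorem lintegral_eq_lintegral_sphere {F : RN N → ℝ≥0∞} (hF : Measurable F) :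
    ∫⁻ x, F x = ∫⁻ ω : Metric.sphere (0 : RN N) 1, (∫⁻ τ in Ioi (0 : ℝ),
      ENNReal.ofReal (τ ^ (N - 1)) * F (τ • (ω : RN N)))
        ∂(volume : Measure (RN N)).toSphere := by
  have hmp := (volume : Measure (RN N)).measurePreserving_homeomorphUnitSphereProd
  have hmeas : Measurable fun z : Metric.sphere (0 : RN N) 1 × Ioi (0 : ℝ) =>
      F ((z.2 : ℝ) • (z.1 : RN N)) :=
    hF.comp ((measurable_subtype_coe.comp measurable_snd).smul
      (measurable_subtype_coe.comp measurable_fst))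
  calc ∫⁻ x, F x = ∫⁻ x in ({0}ᶜ : Set (RN N)), F x := by rw [restrict_compl_singleton]
    _ = ∫⁻ x : ({0}ᶜ : Set (RN N)), F x ∂(volume.comap Subtype.val) :=
        (lintegral_subtype_comap (measurableSet_singleton _).compl F).symm
    _ = ∫⁻ z, F ((z.2 : ℝ) • (z.1 : RN N)) ∂((volume : Measure (RN N)).toSphere.prod
          (Measure.volumeIoiPow (Module.finrank ℝ (RN N) - 1))) := by
        rw [← hmp.lintegral_comp_emb (Homeomorph.measurableEmbedding _)]
        simp only [homeomorphUnitSphereProd_smul]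
    _ = _ := by
        rw [lintegral_prod _ hmeas.aemeasurable]
        refine lintegral_congr fun ω => ?_
        have hmω : Measurable fun τ : ℝ => F (τ • (ω : RN N)) := by fun_prop
        rw [Measure.volumeIoiPow, finrank_euclideanSpace_fin]
        refine (lintegral_withDensity_eq_lintegral_mul _ (by fun_prop)
          (hmω.comp measurable_subtype_coe)).trans ?_
        exact lintegral_subtype_comap measurableSet_Ioi
          (fun τ : ℝ => ENNReal.ofReal (τ ^ (N - 1)) * F (τ • (ω : RN N)))

/-- A property that holds a.e. holds, for a.e. radius, at a.e. point of the sphere. -/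
theorem ae_ae_sphere {P : RN N → Prop} (h : ∀ᵐ x, P x) :
    ∀ᵐ x : RN N, x ≠ 0 ∧ ∀ᵐ ω : Metric.sphere (0 : RN N) 1 ∂(volume : Measure (RN N)).toSphere, P (‖x‖ • (ω : RN N)) := by
  have hmp := (volume : Measure (RN N)).measurePreserving_homeomorphUnitSphereProd
  have hsub : MeasurableEmbedding (Subtype.val : ({0}ᶜ : Set (RN N)) → RN N) :=
    MeasurableEmbedding.subtype_coe (measurableSet_singleton _).compl
  have hmap : Measure.map (Subtype.val : ({0}ᶜ : Set (RN N)) → RN N) (volume.comap Subtype.val) =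
      volume := by
    rw [hsub.map_comap, Subtype.range_coe, restrict_compl_singleton]
  have h1 : ∀ᵐ x : ({0}ᶜ : Set (RN N)) ∂(volume.comap Subtype.val), P x := by
    rw [← hmap, hsub.ae_map_iff] at h
    exact h
  have h2 : ∀ᵐ z ∂((volume : Measure (RN N)).toSphere.prod
      (Measure.volumeIoiPow (Module.finrank ℝ (RN N) - 1))), P ((z.2 : ℝ) • (z.1 : RN N)) := by
    rw [← hmp.map_eq, (Homeomorph.measurableEmbedding _).ae_map_iff]
    simpa only [homeomorphUnitSphereProd_smul] using h1
  -- Polar coordinates list the direction first; the factors are swapped so that the radius becomes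
  -- the outer variable.
  have h3 : ∀ᵐ τ : Ioi (0 : ℝ) ∂(Measure.volumeIoiPow (Module.finrank ℝ (RN N) - 1)),
      ∀ᵐ ω : Metric.sphere (0 : RN N) 1 ∂(volume : Measure (RN N)).toSphere, P ((τ : ℝ) • (ω : RN N)) :=
    Measure.ae_ae_of_ae_prod (Measure.measurePreserving_swap.quasiMeasurePreserving.ae h2)
  have h4 := hmp.quasiMeasurePreserving.ae (Measure.quasiMeasurePreserving_snd.ae h3)
  have h5 : ∀ᵐ x ∂(Measure.map (Subtype.val : ({0}ᶜ : Set (RN N)) → RN N)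
      (volume.comap Subtype.val)), x ≠ 0 ∧
      ∀ᵐ ω : Metric.sphere (0 : RN N) 1 ∂(volume : Measure (RN N)).toSphere,
        P (‖x‖ • (ω : RN N)) := by
    rw [hsub.ae_map_iff]
    filter_upwards [h4] with x hx
    exact ⟨x.2, by simpa using hx⟩
  rwa [hmap] at h5

end Polar

/-! ### Mollification of functions with a weak gradient -/

section Mollification

variable {N : ℕ} {u : RN N → ℝ} {g : RN N → RN N} {ρ : RN N → ℝ}

/-- The derivative of a mollification is the mollification of the weak gradient. -/
theorem IsWeakGradient.fderiv_convolution (h : IsWeakGradient u g)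
    (hu : LocallyIntegrable u volume) (hρ : ContDiff ℝ (⊤ : ℕ∞) ρ) (hc : HasCompactSupport ρ)
    (x v : RN N) :
    fderiv ℝ (ρ ⋆[ContinuousLinearMap.lsmul ℝ ℝ, volume] u) x v =
      ∫ y, ⟪g y, v⟫ * ρ (x - y) := by
  have hρ1 : ContDiff ℝ 1 ρ := hρ.of_le (by exact_mod_cast le_top)
  have hex : Integrable (fun t => (ContinuousLinearMap.lsmul ℝ ℝ).precompL (RN N)
      (fderiv ℝ ρ t) (u (x - t))) volume :=
    HasCompactSupport.convolutionExists_left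
      ((ContinuousLinearMap.lsmul ℝ ℝ : ℝ →L[ℝ] ℝ →L[ℝ] ℝ).precompL (RN N)) (hc.fderiv ℝ)
      (hρ1.continuous_fderiv one_ne_zero) hu x
  rw [(hc.hasFDerivAt_convolution_left (ContinuousLinearMap.lsmul ℝ ℝ) hρ1 hu x).fderiv,
    convolution_def, ContinuousLinearMap.integral_apply hex]
  -- The test function is the reflected and translated kernel; the sign from the reflection cancels
  -- the sign in the definition of the weak gradient.
  have hφ : ContDiff ℝ (⊤ : ℕ∞) fun y => ρ (x - y) := hρ.comp (contDiff_const.sub contDiff_id)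
  have hφc : HasCompactSupport fun y => ρ (x - y) := hc.comp_homeomorph (Homeomorph.subLeft x)
  have hd : ∀ y, fderiv ℝ (fun y => ρ (x - y)) y v = - fderiv ℝ ρ (x - y) v := by
    intro y
    have h1 : HasFDerivAt ρ (fderiv ℝ ρ (x - y)) (x - y) :=
      (hρ1.differentiable one_ne_zero _).hasFDerivAt
    have h2 : HasFDerivAt (fun y : RN N => x - y) (-ContinuousLinearMap.id ℝ (RN N)) y := by
      simpa using (hasFDerivAt_id y).const_sub x
    have h3 : HasFDerivAt (fun y => ρ (x - y))
        ((fderiv ℝ ρ (x - y)).comp (-ContinuousLinearMap.id ℝ (RN N))) y := h1.comp y h2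
    rw [h3.fderiv]
    simp
  have key := h _ hφ hφc v
  simp only [hd, mul_neg, integral_neg, neg_inj] at key
  rw [← key, ← integral_sub_left_eq_self _ volume x]
  refine integral_congr_ae (Eventually.of_forall fun y => ?_)
  simp [ContinuousLinearMap.precompL_apply, mul_comm]

/-- The mollified modulus of `g`. -/
noncomputable def mollEnorm (ρ : RN N → ℝ) (g : RN N → RN N) (x : RN N) : ℝ≥0∞ :=
  ∫⁻ y, ENNReal.ofReal (ρ (x - y)) * ‖g y‖ₑ

theorem measurable_mollEnorm (hρ : Continuous ρ) (hg : Measurable g) :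
    Measurable (mollEnorm ρ g) := by
  have : Measurable fun z : RN N × RN N => ENNReal.ofReal (ρ (z.1 - z.2)) * ‖g z.2‖ₑ := by
    have h1 : Measurable fun z : RN N × RN N => ρ (z.1 - z.2) :=
      hρ.measurable.comp (measurable_fst.sub measurable_snd)
    have h2 : Measurable fun z : RN N × RN N => ‖g z.2‖ₑ := (hg.comp measurable_snd).enorm
    exact h1.ennreal_ofReal.mul h2
  exact this.lintegral_prod_right'

theorem IsWeakGradient.enorm_fderiv_convolution_le (h : IsWeakGradient u g)
    (hu : LocallyIntegrable u volume) (hρ : ContDiff ℝ (⊤ : ℕ∞) ρ) (hc : HasCompactSupport ρ)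
    (h0 : ∀ x, 0 ≤ ρ x) (x : RN N) {v : RN N} (hv : ‖v‖ = 1) :
    ‖fderiv ℝ (ρ ⋆[ContinuousLinearMap.lsmul ℝ ℝ, volume] u) x v‖ₑ ≤ mollEnorm ρ g x := by
  rw [h.fderiv_convolution hu hρ hc]
  refine (enorm_integral_le_lintegral_enorm _).trans (lintegral_mono fun y => ?_)
  rw [enorm_mul, mul_comm, Real.enorm_of_nonneg (h0 _)]
  gcongr
  rw [← ofReal_norm, ← ofReal_norm]
  refine ENNReal.ofReal_le_ofReal ((norm_inner_le_norm _ _).trans ?_)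
  rw [hv, mul_one]

/-- Jensen's inequality for the probability density ρ(x - ·), obtained from Hölder with weights 1 -
1/p and 1/p, followed by Tonelli. -/
theorem lintegral_mollEnorm_rpow_le {p : ℝ} (hp : 1 < p) (hρ : Continuous ρ)
    (h1 : ∫⁻ x, ENNReal.ofReal (ρ x) = 1) (hg : Measurable g) :
    ∫⁻ x, mollEnorm ρ g x ^ p ≤ ∫⁻ x, ‖g x‖ₑ ^ p := by
  have hp0 : 0 < p := by linarith
  have hρm : Measurable fun x => ENNReal.ofReal (ρ x) := hρ.measurable.ennreal_ofReal
  have hρx : ∀ x : RN N, Measurable fun y => ENNReal.ofReal (ρ (x - y)) := fun x =>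
    hρm.comp (measurable_const.sub measurable_id)
  have hpt : ∀ x, mollEnorm ρ g x ^ p ≤ ∫⁻ y, ENNReal.ofReal (ρ (x - y)) * ‖g y‖ₑ ^ p := by
    intro x
    have hθ : 0 ≤ 1 - 1 / p := by rw [sub_nonneg, div_le_one hp0]; exact hp.le
    have hH := ENNReal.lintegral_mul_norm_pow_le (μ := (volume : Measure (RN N)))
      (f := fun y => ENNReal.ofReal (ρ (x - y)))
      (g := fun y => ENNReal.ofReal (ρ (x - y)) * ‖g y‖ₑ ^ p) (hρx x).aemeasurable
      ((hρx x).mul (hg.enorm.pow_const _)).aemeasurable hθ (q := 1 / p) (by positivity) (by ring)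
    rw [lintegral_sub_left_eq_self (fun y => ENNReal.ofReal (ρ y)) x, h1, ENNReal.one_rpow,
      one_mul] at hH
    have hL : mollEnorm ρ g x = ∫⁻ y, ENNReal.ofReal (ρ (x - y)) ^ (1 - 1 / p) *
        (ENNReal.ofReal (ρ (x - y)) * ‖g y‖ₑ ^ p) ^ (1 / p) := by
      refine lintegral_congr fun y => ?_
      rw [ENNReal.mul_rpow_of_nonneg _ _ (by positivity), ← ENNReal.rpow_mul,
        mul_one_div_cancel hp0.ne', ENNReal.rpow_one, ← mul_assoc,
        ← ENNReal.rpow_add_of_nonneg _ _ hθ (by positivity), sub_add_cancel, ENNReal.rpow_one]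
    rw [hL]
    refine (ENNReal.rpow_le_rpow hH hp0.le).trans (le_of_eq ?_)
    rw [← ENNReal.rpow_mul, one_div_mul_cancel hp0.ne', ENNReal.rpow_one]
  have hm2 : Measurable fun z : RN N × RN N => ENNReal.ofReal (ρ (z.1 - z.2)) * ‖g z.2‖ₑ ^ p :=
    (hρm.comp (measurable_fst.sub measurable_snd)).mul
      ((hg.comp measurable_snd).enorm.pow_const _)
  calc ∫⁻ x, mollEnorm ρ g x ^ p
      ≤ ∫⁻ x, ∫⁻ y, ENNReal.ofReal (ρ (x - y)) * ‖g y‖ₑ ^ p := lintegral_mono hpt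
    _ = ∫⁻ y, ∫⁻ x, ENNReal.ofReal (ρ (x - y)) * ‖g y‖ₑ ^ p :=
        lintegral_lintegral_swap hm2.aemeasurable
    _ = ∫⁻ y, ‖g y‖ₑ ^ p := by
        refine lintegral_congr fun y => ?_
        have hρy : Measurable fun x => ENNReal.ofReal (ρ (x - y)) :=
          hρm.comp (measurable_id.sub measurable_const)
        rw [lintegral_mul_const _ hρy,
          lintegral_sub_right_eq_self (fun x => ENNReal.ofReal (ρ x)) y, h1, one_mul]

/-- The fundamental theorem of calculus along a ray. -/
theorem IsWeakGradient.enorm_sub_convolution_le (h : IsWeakGradient u g)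
    (hu : LocallyIntegrable u volume) (hρ : ContDiff ℝ (⊤ : ℕ∞) ρ) (hc : HasCompactSupport ρ)
    (h0 : ∀ x, 0 ≤ ρ x) {ω : RN N} (hω : ‖ω‖ = 1) {s t : ℝ} (hst : s ≤ t) :
    ‖(ρ ⋆[ContinuousLinearMap.lsmul ℝ ℝ, volume] u) (t • ω) -
      (ρ ⋆[ContinuousLinearMap.lsmul ℝ ℝ, volume] u) (s • ω)‖ₑ ≤
      ∫⁻ τ in Ioc s t, mollEnorm ρ g (τ • ω) := by
  set w := ρ ⋆[ContinuousLinearMap.lsmul ℝ ℝ, volume] u with hw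
  have hw1 : ContDiff ℝ 1 w := by
    have := hc.contDiff_convolution_left (ContinuousLinearMap.lsmul ℝ ℝ) (n := 1)
      (hρ.of_le (by exact_mod_cast le_top)) hu
    exact_mod_cast this
  have hder : ∀ τ : ℝ, HasDerivAt (fun τ : ℝ => w (τ • ω)) (fderiv ℝ w (τ • ω) ω) τ := by
    intro τ
    have h1 : HasDerivAt (fun τ : ℝ => τ • ω) ω τ := by
      simpa using (hasDerivAt_id τ).smul_const ω
    exact (hw1.differentiable one_ne_zero _).hasFDerivAt.comp_hasDerivAt τ h1
  have hcont : Continuous fun τ : ℝ => fderiv ℝ w (τ • ω) ω :=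
    ((hw1.continuous_fderiv one_ne_zero).comp (by fun_prop)).clm_apply continuous_const
  have hint := intervalIntegral.integral_eq_sub_of_hasDerivAt (a := s) (b := t)
    (fun τ _ => hder τ) (hcont.intervalIntegrable _ _)
  rw [← hint, intervalIntegral.integral_of_le hst]
  refine (enorm_integral_le_lintegral_enorm _).trans (lintegral_mono fun τ => ?_)
  exact h.enorm_fderiv_convolution_le hu hρ hc h0 _ hω

end Mollification

/-! ### Oscillation of radial functions -/

section RadialOscillation

variable {N : ℕ} {p : ℝ}

/-- A mollifying sequence of bump functions. -/
noncomputable def bumpSeq (N : ℕ) (n : ℕ) : ContDiffBump (0 : RN N) where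
  rIn := 1 / ((n : ℝ) + 1)
  rOut := 2 / ((n : ℝ) + 1)
  rIn_pos := by positivity
  rIn_lt_rOut := by gcongr; norm_num

theorem tendsto_bumpSeq_rOut : Tendsto (fun n => (bumpSeq N n).rOut) atTop (𝓝 0) := by
  have := (tendsto_one_div_add_atTop_nhds_zero_nat (𝕜 := ℝ)).const_mul 2
  simpa [bumpSeq, div_eq_mul_inv] using this

variable [Nontrivial (RN N)]

/-- In polar coordinates the left side is the integral of γ against |x|^{-(N-1)} over an annulus.
Hölder leaves the p/(p-1)-th power of that weight, and with the Jacobian the exponent becomes (N-1)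
- (N-1)p/(p-1) = -(N-1)/(p-1). -/
theorem lintegral_sphere_Ioc_le (hp : 1 < p) {γ : RN N → ℝ≥0∞} (hγ : Measurable γ) {s t : ℝ}
    (hs : 0 < s) :
    ∫⁻ ω : Metric.sphere (0 : RN N) 1, (∫⁻ τ in Ioc s t, γ (τ • (ω : RN N)))
        ∂(volume : Measure (RN N)).toSphere ≤
      (∫⁻ x, γ x ^ p) ^ (1 / p) * ((volume : Measure (RN N)).toSphere univ *
        ∫⁻ τ in Ioc s t, ENNReal.ofReal (τ ^ (-(((N - 1 : ℕ) : ℝ) / (p - 1))))) ^ ((p - 1) / p) := by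
  have hp0 : 0 < p := by linarith
  have hp1 : 0 < p - 1 := by linarith
  have hsub : Ioc s t ∩ Ioi 0 = Ioc s t :=
    inter_eq_left.2 fun τ hτ => hs.trans hτ.1
  let k₀ : ℝ → ℝ≥0∞ := (Ioc s t).indicator fun τ => ENNReal.ofReal ((τ ^ (N - 1))⁻¹)
  have hk₀ : Measurable k₀ := (Measurable.ennreal_ofReal (by fun_prop)).indicator measurableSet_Ioc
  let k : RN N → ℝ≥0∞ := fun x => k₀ ‖x‖
  have hk : Measurable k := hk₀.comp measurable_norm
  have hkω : ∀ (τ : ℝ), τ ∈ Ioi (0 : ℝ) → ∀ ω : Metric.sphere (0 : RN N) 1,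
      k (τ • (ω : RN N)) = k₀ τ := by
    intro τ hτ ω
    have hω : ‖(ω : RN N)‖ = 1 := by simp
    simp only [k, norm_smul, hω, mul_one, Real.norm_eq_abs, abs_of_pos (mem_Ioi.1 hτ)]
  have hind : ∀ f : ℝ → ℝ≥0∞, ∫⁻ τ in Ioi (0 : ℝ), (Ioc s t).indicator f τ =
      ∫⁻ τ in Ioc s t, f τ := by
    intro f
    rw [lintegral_indicator measurableSet_Ioc, Measure.restrict_restrict measurableSet_Ioc, hsub]
  have h1 : ∫⁻ x, k x * γ x = ∫⁻ ω : Metric.sphere (0 : RN N) 1,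
      (∫⁻ τ in Ioc s t, γ (τ • (ω : RN N))) ∂(volume : Measure (RN N)).toSphere := by
    refine (lintegral_eq_lintegral_sphere (hk.mul hγ)).trans (lintegral_congr fun ω => ?_)
    rw [← hind]
    refine setLIntegral_congr_fun measurableSet_Ioi fun τ hτ => ?_
    have hτ0 : (0 : ℝ) < τ := hτ
    by_cases hmem : τ ∈ Ioc s t
    · simp only [k₀, indicator_of_mem hmem, Pi.mul_apply, hkω τ hτ ω]
      rw [← mul_assoc, ← ENNReal.ofReal_mul (by positivity), mul_inv_cancel₀ (by positivity)]
      simp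
    · simp [k₀, indicator_of_notMem hmem, hkω τ hτ ω]
  have h2 : ∫⁻ x, k x ^ (p / (p - 1)) = (volume : Measure (RN N)).toSphere univ *
      ∫⁻ τ in Ioc s t, ENNReal.ofReal (τ ^ (-(((N - 1 : ℕ) : ℝ) / (p - 1)))) := by
    rw [lintegral_eq_lintegral_sphere (hk.pow_const _)]
    have h3 : ∀ ω : Metric.sphere (0 : RN N) 1, ∫⁻ τ in Ioi (0 : ℝ),
        ENNReal.ofReal (τ ^ (N - 1)) * k (τ • (ω : RN N)) ^ (p / (p - 1)) =
        ∫⁻ τ in Ioc s t, ENNReal.ofReal (τ ^ (-(((N - 1 : ℕ) : ℝ) / (p - 1)))) := by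
      intro ω
      rw [← hind]
      refine setLIntegral_congr_fun measurableSet_Ioi fun τ hτ => ?_
      have hτ0 : (0 : ℝ) < τ := hτ
      simp only [hkω τ hτ ω]
      by_cases hmem : τ ∈ Ioc s t
      · simp only [k₀, indicator_of_mem hmem]
        rw [ENNReal.ofReal_rpow_of_nonneg (by positivity) (by positivity),
          ← ENNReal.ofReal_mul (by positivity), ← Real.rpow_natCast, ← Real.rpow_neg hτ0.le,
          ← Real.rpow_mul hτ0.le, ← Real.rpow_add hτ0]
        congr 2
        field_simp
        ring
      · have : 0 < p / (p - 1) := by positivity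
        simp [k₀, indicator_of_notMem hmem, this]
    simp only [h3, lintegral_const]
    rw [mul_comm]
  have hconj : p.HolderConjugate (p / (p - 1)) := Real.HolderConjugate.conjExponent hp
  have hH := ENNReal.lintegral_mul_le_Lp_mul_Lq volume hconj hγ.aemeasurable hk.aemeasurable
  rw [h2] at hH
  have hswap : ∫⁻ x, (γ * k) x = ∫⁻ x, k x * γ x :=
    lintegral_congr fun x => mul_comm _ _
  rw [hswap, h1] at hH
  simpa [one_div_div] using hH

/-- The oscillation estimate for radial functions with a weak gradient. -/
theorem IsWeakGradient.exists_osc_le (hp : 1 < p) {u : RN N → ℝ} {g : RN N → RN N}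
    (h : IsWeakGradient u g) (hu : LocallyIntegrable u volume) (hg : Measurable g)
    (hrad : IsRadialAE u) :
    ∃ E : Set (RN N), (∀ᵐ x, x ∈ E) ∧ ∀ x ∈ E, x ≠ 0 ∧ ∀ y ∈ E, ‖x‖ ≤ ‖y‖ →
      ‖u y - u x‖ₑ * (volume : Measure (RN N)).toSphere univ ≤
        (∫⁻ x, ‖g x‖ₑ ^ p) ^ (1 / p) * ((volume : Measure (RN N)).toSphere univ *
          ∫⁻ τ in Ioc ‖x‖ ‖y‖, ENNReal.ofReal (τ ^ (-(((N - 1 : ℕ) : ℝ) / (p - 1))))) ^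
            ((p - 1) / p) := by
  obtain ⟨f, hf⟩ := hrad
  let ρ : ℕ → RN N → ℝ := fun n => (bumpSeq N n).normed volume
  let w : ℕ → RN N → ℝ := fun n => ρ n ⋆[ContinuousLinearMap.lsmul ℝ ℝ, volume] u
  have hρ : ∀ n, ContDiff ℝ (⊤ : ℕ∞) (ρ n) := fun n => (bumpSeq N n).contDiff_normed
  have hρc : ∀ n, HasCompactSupport (ρ n) := fun n => (bumpSeq N n).hasCompactSupport_normed
  have hρ0 : ∀ n x, 0 ≤ ρ n x := fun n x => (bumpSeq N n).nonneg_normed x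
  have hρ1 : ∀ n, ∫⁻ x, ENNReal.ofReal (ρ n x) = 1 := fun n => by
    rw [← ofReal_integral_eq_lintegral_ofReal (bumpSeq N n).integrable_normed
      (Eventually.of_forall (hρ0 n)), (bumpSeq N n).integral_normed, ENNReal.ofReal_one]
  have hwc : ∀ n, Continuous (w n) := fun n =>
    (hρc n).continuous_convolution_left _ (hρ n).continuous hu
  have hae : ∀ᵐ x, Tendsto (fun n => w n x) atTop (𝓝 (u x)) :=
    ContDiffBump.ae_convolution_tendsto_right_of_locallyIntegrable (K := 2) tendsto_bumpSeq_rOut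
      (Eventually.of_forall fun n => by simp only [bumpSeq]; exact le_of_eq (by ring)) hu
  have hP : ∀ᵐ x, Tendsto (fun n => w n x) atTop (𝓝 (f ‖x‖)) := by
    filter_upwards [hae, hf] with x hx hfx
    rwa [← hfx]
  -- A point is good if u takes the profile value there and the mollifications tend to that value in
  -- almost every direction at the same radius. The mollifications themselves need not be shown
  -- radial.
  refine ⟨{x | u x = f ‖x‖ ∧ x ≠ 0 ∧
    ∀ᵐ ω : Metric.sphere (0 : RN N) 1 ∂(volume : Measure (RN N)).toSphere,
      Tendsto (fun n => w n (‖x‖ • (ω : RN N))) atTop (𝓝 (f ‖x‖))}, ?_, ?_⟩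
  · filter_upwards [hf, ae_ae_sphere hP] with x hx hx'
    refine ⟨hx, hx'.1, ?_⟩
    filter_upwards [hx'.2] with ω hω
    have h1 : ‖(ω : RN N)‖ = 1 := by simp
    simpa [norm_smul, h1] using hω
  · rintro x ⟨hxf, hx0, hx⟩
    refine ⟨hx0, ?_⟩
    rintro y ⟨hyf, -, hy⟩ hxy
    have hnx : 0 < ‖x‖ := norm_pos_iff.2 hx0
    have hbound : ∀ n, ∫⁻ ω : Metric.sphere (0 : RN N) 1,
        ‖w n (‖y‖ • (ω : RN N)) - w n (‖x‖ • (ω : RN N))‖ₑ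
          ∂(volume : Measure (RN N)).toSphere ≤ (∫⁻ x, ‖g x‖ₑ ^ p) ^ (1 / p) *
        ((volume : Measure (RN N)).toSphere univ * ∫⁻ τ in Ioc ‖x‖ ‖y‖,
          ENNReal.ofReal (τ ^ (-(((N - 1 : ℕ) : ℝ) / (p - 1))))) ^ ((p - 1) / p) := by
      intro n
      refine (lintegral_mono fun ω => h.enorm_sub_convolution_le hu (hρ n) (hρc n) (hρ0 n)
        (by simp) hxy).trans ?_
      refine (lintegral_sphere_Ioc_le hp (measurable_mollEnorm (hρ n).continuous hg) hnx).trans ?_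
      gcongr ?_ ^ (1 / p) * _
      exact lintegral_mollEnorm_rpow_le hp (hρ n).continuous (hρ1 n) hg
    have hmeas : ∀ n, Measurable fun ω : Metric.sphere (0 : RN N) 1 =>
        ‖w n (‖y‖ • (ω : RN N)) - w n (‖x‖ • (ω : RN N))‖ₑ := by
      intro n
      have := hwc n
      have hc : Continuous fun ω : Metric.sphere (0 : RN N) 1 =>
        w n (‖y‖ • (ω : RN N)) - w n (‖x‖ • (ω : RN N)) := by fun_prop
      exact hc.measurable.enorm
    calc ‖u y - u x‖ₑ * (volume : Measure (RN N)).toSphere univ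
        = ∫⁻ _ω : Metric.sphere (0 : RN N) 1, ‖f ‖y‖ - f ‖x‖‖ₑ
            ∂(volume : Measure (RN N)).toSphere := by
          rw [lintegral_const, hxf, hyf]
      -- The bound is uniform in n, so Fatou's lemma on the sphere transfers it to the limit.
      _ = ∫⁻ ω : Metric.sphere (0 : RN N) 1, liminf (fun n =>
            ‖w n (‖y‖ • (ω : RN N)) - w n (‖x‖ • (ω : RN N))‖ₑ) atTop
            ∂(volume : Measure (RN N)).toSphere := by
          refine lintegral_congr_ae ?_
          filter_upwards [hx, hy] with ω hω hω'
          exact (hω'.sub hω).enorm.liminf_eq.symm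
      _ ≤ liminf (fun n => ∫⁻ ω : Metric.sphere (0 : RN N) 1,
            ‖w n (‖y‖ • (ω : RN N)) - w n (‖x‖ • (ω : RN N))‖ₑ
              ∂(volume : Measure (RN N)).toSphere) atTop := lintegral_liminf_le hmeas
      _ ≤ _ := liminf_le_of_frequently_le' (Frequently.of_forall hbound)

end RadialOscillation

/-! ### Pointwise bounds for radial Sobolev functions -/

section RadialBounds

variable {N : ℕ} {p : ℝ}

/-- On `E`, the oscillation of `u` between two radii is controlled, with constant `A`, by any bound
`J` of the corresponding integral of the weight. -/
def HasOscBound (p A : ℝ) (u : RN N → ℝ) (E : Set (RN N)) : Prop :=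
  ∀ x ∈ E, x ≠ 0 ∧ ∀ y ∈ E, ‖x‖ ≤ ‖y‖ → ∀ J : ℝ, 0 ≤ J →
    ∫⁻ τ in Ioc ‖x‖ ‖y‖, ENNReal.ofReal (τ ^ (-(((N - 1 : ℕ) : ℝ) / (p - 1)))) ≤
      ENNReal.ofReal J → |u y - u x| ≤ A * J ^ ((p - 1) / p)

theorem lintegral_rpow_le_of_norm_le {E : Type*} [NormedAddCommGroup E] (hp : 0 < p)
    {f : Lp E (ENNReal.ofReal p) (volume : Measure (RN N))} {M : ℝ} (h : ‖f‖ ≤ M) :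
    ∫⁻ x, ‖f x‖ₑ ^ p ≤ ENNReal.ofReal M ^ p := by
  rw [lintegral_rpow_eq_eLpNorm_rpow hp]
  gcongr
  rw [Lp.norm_def] at h
  exact (ENNReal.le_ofReal_iff_toReal_le (Lp.eLpNorm_lt_top f).ne
    (ENNReal.toReal_nonneg.trans h)).2 h

theorem exists_hasOscBound [Nontrivial (RN N)] [Fact (1 < p)] :
    ∃ C : ℝ, 0 < C ∧ ∀ M : ℝ, 0 ≤ M → ∀ w ∈ SobolevRadial N p, ‖w‖ ≤ M →
      ∃ E : Set (RN N), (∀ᵐ x, x ∈ E) ∧ HasOscBound p (C * M) (w.1 : RN N → ℝ) E := by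
  have hp : 1 < p := Fact.out
  have hp0 : 0 < p := by linarith
  set σ := (volume : Measure (RN N)).toSphere univ with hσ
  have hσ0 : σ ≠ 0 := by
    rw [hσ, Ne, Measure.measure_univ_eq_zero]
    exact Measure.toSphere_ne_zero _
  have hσt : σ ≠ ∞ := measure_ne_top _ _
  set S := σ.toReal with hS
  have hS0 : 0 < S := ENNReal.toReal_pos hσ0 hσt
  have hσS : σ = ENNReal.ofReal S := (ENNReal.ofReal_toReal hσt).symm
  refine ⟨S ^ ((p - 1) / p) / S, by positivity, fun M hM w hw hwM => ?_⟩
  obtain ⟨hgrad, hrad⟩ := hw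
  have hu : LocallyIntegrable (w.1 : RN N → ℝ) volume :=
    (Lp.memLp w.1).locallyIntegrable (Fact.out)
  obtain ⟨E, hE, hosc⟩ := hgrad.exists_osc_le hp hu (Lp.stronglyMeasurable w.2).measurable hrad
  refine ⟨E, hE, fun x hx => ⟨(hosc x hx).1, fun y hy hxy J hJ hle => ?_⟩⟩
  have h1 := (hosc x hx).2 y hy hxy
  have h2 : (∫⁻ x, ‖w.2 x‖ₑ ^ p) ^ (1 / p) ≤ ENNReal.ofReal M := by
    refine (ENNReal.rpow_le_rpow (lintegral_rpow_le_of_norm_le hp0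
      ((norm_snd_le w).trans hwM)) (by positivity)).trans (le_of_eq ?_)
    rw [← ENNReal.rpow_mul, mul_one_div_cancel hp0.ne', ENNReal.rpow_one]
  have hpp : 0 ≤ (p - 1) / p := div_nonneg (by linarith) hp0.le
  have h3 : ENNReal.ofReal (|w.1 y - w.1 x| * S) ≤
      ENNReal.ofReal (M * (S * J) ^ ((p - 1) / p)) := by
    calc ENNReal.ofReal (|w.1 y - w.1 x| * S) = ‖w.1 y - w.1 x‖ₑ * σ := by
          rw [ENNReal.ofReal_mul (abs_nonneg _), ← hσS, Real.enorm_eq_ofReal_abs]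
      _ ≤ _ := h1
      _ ≤ ENNReal.ofReal M * (ENNReal.ofReal S * ENNReal.ofReal J) ^ ((p - 1) / p) := by
          rw [← hσS]; gcongr
      _ = _ := by
          rw [← ENNReal.ofReal_mul hS0.le, ENNReal.ofReal_rpow_of_nonneg (by positivity) hpp,
            ← ENNReal.ofReal_mul hM]
  have h4 := (ENNReal.ofReal_le_ofReal_iff (by positivity)).1 h3
  rw [Real.mul_rpow hS0.le hJ] at h4
  calc |w.1 y - w.1 x| = |w.1 y - w.1 x| * S / S := by field_simp
    _ ≤ M * (S ^ ((p - 1) / p) * J ^ ((p - 1) / p)) / S := by gcongr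
    _ = _ := by ring

/-- The weight is decreasing in τ, so on the interval it is at most its value at the inner radius;
the exponents then combine to (N-1)/p. -/
theorem HasOscBound.abs_sub_le (hp : 1 < p) {A : ℝ} {u : RN N → ℝ} {E : Set (RN N)}
    (h : HasOscBound p A u E) {x y : RN N} (hx : x ∈ E) (hy : y ∈ E) (hxy : ‖x‖ ≤ ‖y‖) :
    |u y - u x| ≤ A * (‖x‖ ^ (-(((N - 1 : ℕ) : ℝ) / p)) * (‖y‖ - ‖x‖) ^ ((p - 1) / p)) := by
  have hx0 : 0 < ‖x‖ := norm_pos_iff.2 (h x hx).1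
  have hp1 : 0 < p - 1 := by linarith
  have hp0 : 0 < p := by linarith
  have hsub : 0 ≤ ‖y‖ - ‖x‖ := sub_nonneg.2 hxy
  have h1 := (h x hx).2 y hy hxy
    (‖x‖ ^ (-(((N - 1 : ℕ) : ℝ) / (p - 1))) * (‖y‖ - ‖x‖)) (by positivity) ?_
  · rw [Real.mul_rpow (by positivity) hsub, ← Real.rpow_mul hx0.le] at h1
    convert h1 using 4
    field_simp
  · calc ∫⁻ τ in Ioc ‖x‖ ‖y‖, ENNReal.ofReal (τ ^ (-(((N - 1 : ℕ) : ℝ) / (p - 1))))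
        ≤ ∫⁻ τ in Ioc ‖x‖ ‖y‖, ENNReal.ofReal (‖x‖ ^ (-(((N - 1 : ℕ) : ℝ) / (p - 1)))) := by
          refine setLIntegral_mono' measurableSet_Ioc fun τ hτ => ?_
          refine ENNReal.ofReal_le_ofReal (Real.rpow_le_rpow_of_nonpos hx0 hτ.1.le ?_)
          have : 0 ≤ ((N - 1 : ℕ) : ℝ) / (p - 1) := by positivity
          linarith
      _ = _ := by
          rw [lintegral_const, Measure.restrict_apply_univ, Real.volume_Ioc,
            ← ENNReal.ofReal_mul (by positivity)]

/-- In units of the unit ball this is (t+1)^N ≥ t^{N-1}(t+1) = t^{N-1} + t^N. -/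
theorem volume_annulus_ge (hN : 1 ≤ N) {t : ℝ} (ht : 0 ≤ t) :
    ENNReal.ofReal (t ^ (N - 1)) * volume (Metric.ball (0 : RN N) 1) ≤
      volume {y : RN N | t < ‖y‖ ∧ ‖y‖ ≤ t + 1} := by
  have hb : volume (Metric.ball (0 : RN N) 1) ≠ ∞ := measure_ball_lt_top.ne
  have h1 : Metric.closedBall (0 : RN N) (t + 1) ⊆
      {y : RN N | t < ‖y‖ ∧ ‖y‖ ≤ t + 1} ∪ Metric.closedBall (0 : RN N) t := by
    intro y hy
    rw [mem_closedBall_zero_iff] at hy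
    rcases le_or_gt ‖y‖ t with h | h
    · exact Or.inr (mem_closedBall_zero_iff.2 h)
    · exact Or.inl ⟨h, hy⟩
  have h2 := (measure_mono h1).trans (measure_union_le (μ := (volume : Measure (RN N))) _ _)
  rw [Measure.addHaar_closedBall _ _ (by linarith), Measure.addHaar_closedBall _ _ ht,
    finrank_euclideanSpace_fin] at h2
  have h3 : ENNReal.ofReal (t ^ (N - 1)) * volume (Metric.ball (0 : RN N) 1) +
      ENNReal.ofReal (t ^ N) * volume (Metric.ball (0 : RN N) 1) ≤
      ENNReal.ofReal ((t + 1) ^ N) * volume (Metric.ball (0 : RN N) 1) := by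
    rw [← add_mul, ← ENNReal.ofReal_add (by positivity) (by positivity)]
    gcongr
    obtain ⟨n, rfl⟩ : ∃ n, N = n + 1 := ⟨N - 1, by omega⟩
    have h4 : t ^ n ≤ (t + 1) ^ n := by gcongr; linarith
    simp only [Nat.add_sub_cancel, pow_succ]
    nlinarith
  have h5 := h3.trans h2
  exact (ENNReal.add_le_add_iff_right (ENNReal.mul_ne_top ENNReal.ofReal_ne_top hb)).1 h5

theorem exists_mem_annulus (hN : 1 ≤ N) {E : Set (RN N)} (hE : ∀ᵐ x, x ∈ E) :
    ∃ y ∈ E, 1 < ‖y‖ ∧ ‖y‖ ≤ 2 := by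
  by_contra! hcon
  have h1 := volume_annulus_ge hN (t := 1) zero_le_one
  have h2 : volume {y : RN N | 1 < ‖y‖ ∧ ‖y‖ ≤ 1 + 1} = 0 := by
    refine measure_mono_null (t := Eᶜ) ?_ (ae_iff.1 hE)
    intro y hy hyE
    have h3 := hcon y hyE hy.1
    have h4 := hy.2
    linarith
  rw [h2, one_pow, ENNReal.ofReal_one, one_mul] at h1
  exact (Metric.measure_ball_pos volume (0 : RN N) one_pos).ne' (le_antisymm h1 zero_le)

/-- Strauss' decay estimate. -/
theorem HasOscBound.abs_le (hN : 1 ≤ N) (hp : 1 < p) {A M : ℝ} (hM : 0 ≤ M) {u : RN N → ℝ}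
    {E : Set (RN N)} (h : HasOscBound p A u E) (hA : 0 ≤ A) (hE : ∀ᵐ x, x ∈ E)
    (hu : ∫⁻ x, ‖u x‖ₑ ^ p ≤ ENNReal.ofReal M ^ p) {x : RN N} (hx : x ∈ E) :
    |u x| ≤ (A + ((volume (Metric.ball (0 : RN N) 1)).toReal ^ (1 / p))⁻¹ * M) *
      ‖x‖ ^ (-(((N - 1 : ℕ) : ℝ) / p)) := by
  have hx0 : 0 < ‖x‖ := norm_pos_iff.2 (h x hx).1
  have hp1 : 0 < p - 1 := by linarith
  have hp0 : 0 < p := by linarith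
  set b := volume (Metric.ball (0 : RN N) 1) with hb
  have hbt : b ≠ ∞ := measure_ball_lt_top.ne
  have hb0 : 0 < b.toReal :=
    ENNReal.toReal_pos (Metric.measure_ball_pos volume (0 : RN N) one_pos).ne' hbt
  set D := ‖x‖ ^ (-(((N - 1 : ℕ) : ℝ) / p)) with hD
  have hD0 : 0 < D := by positivity
  have hnn : 0 ≤ (b.toReal ^ (1 / p))⁻¹ * M * D := by positivity
  -- L is what remains of |u x| after the largest drop of u over the unit-thick annulus just outside
  -- x. If L > 0, then |u| ≥ L on that annulus, whose volume is at least of order |x|^{N-1}, and the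
  -- L^p bound limits L.
  set L := |u x| - A * D with hL
  rcases le_or_gt L 0 with hL0 | hL0
  · rw [add_mul]; linarith
  have hAnn : ∀ᵐ y, y ∈ {y : RN N | ‖x‖ < ‖y‖ ∧ ‖y‖ ≤ ‖x‖ + 1} → L ≤ |u y| := by
    filter_upwards [hE] with y hy hyA
    have h1 := h.abs_sub_le hp hx hy hyA.1.le
    have h2 : (‖y‖ - ‖x‖) ^ ((p - 1) / p) ≤ 1 :=
      Real.rpow_le_one (by linarith [hyA.1]) (by linarith [hyA.2]) (by positivity)
    have h3 : |u y - u x| ≤ A * D := by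
      refine h1.trans (mul_le_mul_of_nonneg_left ?_ hA)
      exact mul_le_of_le_one_right hD0.le h2
    have h4 := abs_sub_abs_le_abs_sub (u x) (u y)
    rw [abs_sub_comm] at h4
    rw [hL]; linarith
  have hmeasA : MeasurableSet {y : RN N | ‖x‖ < ‖y‖ ∧ ‖y‖ ≤ ‖x‖ + 1} :=
    (measurableSet_lt measurable_const measurable_norm).inter
      (measurableSet_le measurable_norm measurable_const)
  have h5 : ENNReal.ofReal (L ^ p * (‖x‖ ^ (N - 1) * b.toReal)) ≤ ENNReal.ofReal (M ^ p) := by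
    calc ENNReal.ofReal (L ^ p * (‖x‖ ^ (N - 1) * b.toReal))
        = ENNReal.ofReal L ^ p * (ENNReal.ofReal (‖x‖ ^ (N - 1)) * b) := by
          rw [ENNReal.ofReal_mul (by positivity), ENNReal.ofReal_mul (by positivity),
            ENNReal.ofReal_toReal hbt, ENNReal.ofReal_rpow_of_nonneg hL0.le hp0.le]
      _ ≤ ENNReal.ofReal L ^ p * volume {y : RN N | ‖x‖ < ‖y‖ ∧ ‖y‖ ≤ ‖x‖ + 1} := by
          gcongr
          exact volume_annulus_ge hN hx0.le
      _ = ∫⁻ _y in {y : RN N | ‖x‖ < ‖y‖ ∧ ‖y‖ ≤ ‖x‖ + 1}, ENNReal.ofReal L ^ p := by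
          rw [lintegral_const, Measure.restrict_apply_univ]
      _ ≤ ∫⁻ y in {y : RN N | ‖x‖ < ‖y‖ ∧ ‖y‖ ≤ ‖x‖ + 1}, ‖u y‖ₑ ^ p := by
          refine lintegral_mono_ae ?_
          filter_upwards [(ae_restrict_iff' hmeasA).2 hAnn] with y hy
          gcongr
          rw [Real.enorm_eq_ofReal_abs]
          exact ENNReal.ofReal_le_ofReal hy
      _ ≤ ∫⁻ y, ‖u y‖ₑ ^ p := setLIntegral_le_lintegral _ _
      _ ≤ _ := by rw [← ENNReal.ofReal_rpow_of_nonneg hM hp0.le]; exact hu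
  have h6 := (ENNReal.ofReal_le_ofReal_iff (by positivity)).1 h5
  have h7 : L * (‖x‖ ^ (((N - 1 : ℕ) : ℝ) / p) * b.toReal ^ (1 / p)) ≤ M := by
    have h8 := Real.rpow_le_rpow (by positivity) h6 (z := 1 / p) (by positivity)
    rw [Real.mul_rpow (by positivity) (by positivity), Real.mul_rpow (by positivity)
      (by positivity), ← Real.rpow_mul hL0.le, ← Real.rpow_mul hM, mul_one_div_cancel hp0.ne',
      Real.rpow_one, Real.rpow_one, ← Real.rpow_natCast, ← Real.rpow_mul hx0.le,
      mul_one_div] at h8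
    exact h8
  have h9 : L ≤ (b.toReal ^ (1 / p))⁻¹ * M * D := by
    rw [hD, Real.rpow_neg hx0.le]
    have hX : 0 < ‖x‖ ^ (((N - 1 : ℕ) : ℝ) / p) := by positivity
    have hB : 0 < b.toReal ^ (1 / p) := by positivity
    rw [inv_mul_eq_div, ← div_eq_mul_inv, div_div, le_div_iff₀ (by positivity)]
    rwa [mul_comm (b.toReal ^ (1 / p))]
  rw [add_mul]; linarith

/-- Since τ ≤ 2, raising the exponent from β to β' costs only the factor 2^{β'-β}, and β' > 1 makes
the integral up to infinity finite. The range β ≤ 1, which occurs for p ≥ N, needs no separate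
treatment. -/
theorem lintegral_Ioc_rpow_le {β β' s t : ℝ} (hβ : β ≤ β') (hβ' : 1 < β') (hs : 0 < s)
    (ht : t ≤ 2) :
    ∫⁻ τ in Ioc s t, ENNReal.ofReal (τ ^ (-β)) ≤
      ENNReal.ofReal (2 ^ (β' - β) / (β' - 1) * s ^ (1 - β')) := by
  have hint := integrableOn_Ioi_rpow_of_lt (a := -β') (by linarith) hs
  have hb1 : 0 < β' - 1 := by linarith
  calc ∫⁻ τ in Ioc s t, ENNReal.ofReal (τ ^ (-β))
      ≤ ∫⁻ τ in Ioc s t, ENNReal.ofReal (2 ^ (β' - β) * τ ^ (-β')) := by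
        refine setLIntegral_mono' measurableSet_Ioc fun τ hτ => ENNReal.ofReal_le_ofReal ?_
        have hτ0 : 0 < τ := hs.trans hτ.1
        have h1 : τ ^ (-β) = τ ^ (β' - β) * τ ^ (-β') := by
          rw [← Real.rpow_add hτ0]; ring_nf
        rw [h1]
        gcongr
        exact hτ.2.trans ht
    _ ≤ ∫⁻ τ in Ioi s, ENNReal.ofReal (2 ^ (β' - β) * τ ^ (-β')) :=
        lintegral_mono_set Ioc_subset_Ioi_self
    _ = ENNReal.ofReal (∫ τ in Ioi s, 2 ^ (β' - β) * τ ^ (-β')) := by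
        rw [ofReal_integral_eq_lintegral_ofReal (hint.const_mul _)]
        filter_upwards [ae_restrict_mem measurableSet_Ioi] with τ hτ
        have hτ0 : 0 < τ := hs.trans hτ
        positivity
    _ = _ := by
        rw [integral_const_mul, integral_Ioi_rpow_of_lt (by linarith) hs]
        congr 1
        rw [show -β' + 1 = -(β' - 1) by ring, show 1 - β' = -(β' - 1) by ring]
        field_simp

/-- The pointwise bound of radial functions near the origin. -/
theorem HasOscBound.abs_le_near_zero (hN : 1 ≤ N) (hp : 1 < p) {α A B : ℝ} (hα : 0 < α)
    (hαN : ((N : ℝ) - p) / p ≤ α) {u : RN N → ℝ} {E : Set (RN N)} (h : HasOscBound p A u E)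
    (hB : 0 ≤ B) (hE : ∀ᵐ x, x ∈ E)
    (hdec : ∀ x ∈ E, |u x| ≤ B * ‖x‖ ^ (-(((N - 1 : ℕ) : ℝ) / p))) {x : RN N} (hx : x ∈ E)
    (hx1 : ‖x‖ ≤ 1) :
    |u x| ≤ (B + A * (2 ^ (1 + α * p / (p - 1) - ((N - 1 : ℕ) : ℝ) / (p - 1)) /
      (α * p / (p - 1))) ^ ((p - 1) / p)) * ‖x‖ ^ (-α) := by
  have hx0 : 0 < ‖x‖ := norm_pos_iff.2 (h x hx).1
  have hp1 : 0 < p - 1 := by linarith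
  have hp0 : 0 < p := by linarith
  -- An anchor point at which the decay estimate gives |u y| ≤ B; the oscillation bound carries this
  -- inwards to x.
  obtain ⟨y, hy, hy1, hy2⟩ := exists_mem_annulus hN hE
  -- The exponent β' = 1 + αp/(p-1) is chosen so that (1-β')(p-1)/p = -α. The assumption (N-p)/p ≤ α
  -- is equivalent to β ≤ β'.
  have hβ : ((N - 1 : ℕ) : ℝ) / (p - 1) ≤ 1 + α * p / (p - 1) := by
    rw [div_le_iff₀ hp0] at hαN
    rw [Nat.cast_sub hN, div_le_iff₀ hp1, add_mul, div_mul_cancel₀ _ hp1.ne']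
    push_cast
    linarith
  have hβ1 : 1 < 1 + α * p / (p - 1) := by
    have : 0 < α * p / (p - 1) := by positivity
    linarith
  have hJ := lintegral_Ioc_rpow_le (s := ‖x‖) (t := ‖y‖) hβ hβ1 hx0 hy2
  rw [show 1 + α * p / (p - 1) - 1 = α * p / (p - 1) by ring,
    show 1 - (1 + α * p / (p - 1)) = -(α * p / (p - 1)) by ring] at hJ
  have h1 := (h x hx).2 y hy (hx1.trans hy1.le) _ (by positivity) hJ
  rw [Real.mul_rpow (by positivity) (by positivity), ← Real.rpow_mul hx0.le,
    show -(α * p / (p - 1)) * ((p - 1) / p) = -α by field_simp] at h1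
  have h2 : |u y| ≤ B := by
    refine (hdec y hy).trans (mul_le_of_le_one_right hB ?_)
    refine Real.rpow_le_one_of_one_le_of_nonpos hy1.le ?_
    have : 0 ≤ ((N - 1 : ℕ) : ℝ) / p := by positivity
    linarith
  have h3 : 1 ≤ ‖x‖ ^ (-α) :=
    Real.one_le_rpow_of_pos_of_le_one_of_nonpos hx0 hx1 (by linarith)
  have h4 : |u x| ≤ |u y| + |u y - u x| := by
    have := abs_sub_abs_le_abs_sub (u x) (u y)
    rw [abs_sub_comm] at this
    linarith
  have h5 : B ≤ B * ‖x‖ ^ (-α) := le_mul_of_one_le_right hB h3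
  rw [add_mul, mul_assoc]
  linarith

/-- Uniform pointwise bounds on bounded sets of radial Sobolev functions. -/
theorem exists_radial_bounds [Fact (1 < p)] (hN : 1 ≤ N) {α : ℝ} (hα : 0 < α)
    (hαN : ((N : ℝ) - p) / p ≤ α) :
    ∃ C : ℝ, 0 < C ∧ ∀ M : ℝ, 0 ≤ M → ∀ w ∈ SobolevRadial N p, ‖w‖ ≤ M →
      ∃ E : Set (RN N), (∀ᵐ x, x ∈ E) ∧ (∀ x ∈ E, x ≠ 0) ∧
        (∀ x ∈ E, |w.1 x| ≤ C * M * ‖x‖ ^ (-(((N - 1 : ℕ) : ℝ) / p))) ∧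
        (∀ x ∈ E, ‖x‖ ≤ 1 → |w.1 x| ≤ C * M * ‖x‖ ^ (-α)) ∧
        ∀ x ∈ E, ∀ y ∈ E, ‖x‖ ≤ ‖y‖ → |w.1 y - w.1 x| ≤
          C * M * (‖x‖ ^ (-(((N - 1 : ℕ) : ℝ) / p)) * (‖y‖ - ‖x‖) ^ ((p - 1) / p)) := by
  have hp : 1 < p := Fact.out
  have hp1 : 0 < p - 1 := by linarith
  have hp0 : 0 < p := by linarith
  have : NeZero N := ⟨by omega⟩
  have : Nontrivial (RN N) := inferInstance
  obtain ⟨C, hC, hosc⟩ := exists_hasOscBound (N := N) (p := p)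
  set c₁ := ((volume (Metric.ball (0 : RN N) 1)).toReal ^ (1 / p))⁻¹
  have hc₁ : 0 ≤ c₁ := by positivity
  set c₂ := (2 ^ (1 + α * p / (p - 1) - ((N - 1 : ℕ) : ℝ) / (p - 1)) /
      (α * p / (p - 1))) ^ ((p - 1) / p)
  have hc₂ : 0 ≤ c₂ := by positivity
  refine ⟨C + c₁ + C * c₂, by positivity, fun M hM w hw hwM => ?_⟩
  obtain ⟨E, hE, hb⟩ := hosc M hM w hw hwM
  have hdec : ∀ x ∈ E, |w.1 x| ≤ (C * M + c₁ * M) * ‖x‖ ^ (-(((N - 1 : ℕ) : ℝ) / p)) :=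
    fun x hx => hb.abs_le hN hp hM (by positivity) hE
      (lintegral_rpow_le_of_norm_le hp0 ((norm_fst_le w).trans hwM)) hx
  refine ⟨E, hE, fun x hx => (hb x hx).1, fun x hx => ?_, fun x hx hx1 => ?_,
    fun x hx y hy hxy => ?_⟩
  · refine (hdec x hx).trans (mul_le_mul_of_nonneg_right ?_ (by positivity))
    have : 0 ≤ C * c₂ * M := by positivity
    linarith
  · refine (hb.abs_le_near_zero hN hp hα hαN (by positivity) hE hdec hx hx1).trans
      (mul_le_mul_of_nonneg_right (le_of_eq ?_) (by positivity))
    ring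
  · refine (hb.abs_sub_le hp hx hy hxy).trans (mul_le_mul_of_nonneg_right ?_
      (mul_nonneg (by positivity) (Real.rpow_nonneg (sub_nonneg.2 hxy) _)))
    have h1 : 0 ≤ c₁ * M := by positivity
    have h2 : 0 ≤ C * c₂ * M := by positivity
    linarith

end RadialBounds

/-! ### Integrability and convergence from power-type bounds -/

section Decay

variable {N : ℕ} {A α κ p s : ℝ}

theorem lintegral_ball_rpow_lt_top (hN : 1 ≤ N) (hA : 0 ≤ A) (hs : 0 < s) (hαs : α * s < N)
    (R : ℝ) :
    ∫⁻ x in Metric.ball (0 : RN N) R, ENNReal.ofReal (A * ‖x‖ ^ (-α)) ^ s < ∞ := by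
  have hm : AEStronglyMeasurable (fun x : RN N => A ^ s * ‖x‖ ^ (-(α * s))) volume :=
    ((measurable_norm.pow_const _).const_mul _).aestronglyMeasurable
  have h1 := integrableOn_ball_of_norm_le_rpow (μ := (volume : Measure (RN N))) (C := A ^ s)
    (α := α * s) (r := R) (by simpa using hN) (by simpa using hαs)
    (f := fun x : RN N => A ^ s * ‖x‖ ^ (-(α * s)))
    (Eventually.of_forall fun x => by
      rw [Real.norm_of_nonneg (by positivity)]) hm
  have h2 := h1.hasFiniteIntegral
  rw [hasFiniteIntegral_iff_ofReal (Eventually.of_forall fun x => by positivity)] at h2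
  refine lt_of_le_of_lt (le_of_eq (lintegral_congr fun x => ?_)) h2
  rw [ENNReal.ofReal_rpow_of_nonneg (by positivity) hs.le, Real.mul_rpow hA (by positivity),
    ← Real.rpow_mul (norm_nonneg _)]
  ring_nf

theorem enorm_rpow_le_mul_rpow {c y : ℝ} (hp : 0 < p) (hps : p ≤ s) (hy : |y| ≤ c) :
    ‖y‖ₑ ^ s ≤ ENNReal.ofReal c ^ (s - p) * ‖y‖ₑ ^ p := by
  have h1 : ‖y‖ₑ ^ s = ‖y‖ₑ ^ (s - p) * ‖y‖ₑ ^ p := by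
    rw [← ENNReal.rpow_add_of_nonneg _ _ (by linarith) hp.le, sub_add_cancel]
  rw [h1]
  gcongr
  rw [Real.enorm_eq_ofReal_abs]
  exact ENNReal.ofReal_le_ofReal hy

/-- The power-type bounds `A |x|^{-α}` near the origin and `A |x|^{-κ}` at infinity. -/
def HasDecay (A α κ : ℝ) (u : RN N → ℝ) : Prop :=
  ∀ᵐ x, (‖x‖ ≤ 1 → |u x| ≤ A * ‖x‖ ^ (-α)) ∧ (1 ≤ ‖x‖ → |u x| ≤ A * ‖x‖ ^ (-κ))

/-- Merges the two regimes into one majorant: for 1 ≤ |x| < R one has R^α |x|^{-α} ≥ 1. -/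
theorem HasDecay.le_on_ball {u : RN N → ℝ} (h : HasDecay A α κ u) (hA : 0 ≤ A) (hα : 0 ≤ α)
    (hκ : 0 ≤ κ) {R : ℝ} (hR : 1 ≤ R) :
    ∀ᵐ x, x ∈ Metric.ball (0 : RN N) R → |u x| ≤ A * R ^ α * ‖x‖ ^ (-α) := by
  filter_upwards [h] with x hx hxR
  rw [mem_ball_zero_iff] at hxR
  have hR0 : 0 < R := by linarith
  rcases le_total ‖x‖ 1 with hx1 | hx1
  · refine (hx.1 hx1).trans (mul_le_mul_of_nonneg_right ?_ (by positivity))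
    exact le_mul_of_one_le_right hA (Real.one_le_rpow hR hα)
  · have hx0 : 0 < ‖x‖ := by linarith
    have h1 : ‖x‖ ^ (-κ) ≤ 1 := Real.rpow_le_one_of_one_le_of_nonpos hx1 (by linarith)
    have h2 : 1 ≤ R ^ α * ‖x‖ ^ (-α) := by
      rw [Real.rpow_neg hx0.le, ← div_eq_mul_inv, one_le_div (by positivity)]
      exact Real.rpow_le_rpow hx0.le hxR.le hα
    rw [mul_assoc]
    exact (hx.2 hx1).trans (mul_le_mul_of_nonneg_left (h1.trans h2) hA)

theorem HasDecay.le_off_ball {u : RN N → ℝ} (h : HasDecay A α κ u) (hA : 0 ≤ A)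
    (hκ : 0 ≤ κ) {R : ℝ} (hR : 1 ≤ R) :
    ∀ᵐ x, x ∈ (Metric.ball (0 : RN N) R)ᶜ → |u x| ≤ A * R ^ (-κ) := by
  filter_upwards [h] with x hx hxR
  rw [mem_compl_iff, mem_ball_zero_iff, not_lt] at hxR
  refine (hx.2 (hR.trans hxR)).trans (mul_le_mul_of_nonneg_left ?_ hA)
  exact Real.rpow_le_rpow_of_nonpos (by linarith) hxR (by linarith)

/-- Off the ball the spare power |u|^{s-p} is at most (A R^{-κ})^{s-p}. For κ > 0 and s > p this
tends to 0 as R grows, uniformly over an L^p-bounded family with the same A, so no mass escapes to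
infinity. -/
theorem HasDecay.setLIntegral_compl_le {u : RN N → ℝ} (h : HasDecay A α κ u) (hA : 0 ≤ A)
    (hκ : 0 ≤ κ) (hp : 0 < p) (hps : p ≤ s) {R : ℝ} (hR : 1 ≤ R) :
    ∫⁻ x in (Metric.ball (0 : RN N) R)ᶜ, ‖u x‖ₑ ^ s ≤
      ENNReal.ofReal (A * R ^ (-κ)) ^ (s - p) * ∫⁻ x, ‖u x‖ₑ ^ p := by
  calc ∫⁻ x in (Metric.ball (0 : RN N) R)ᶜ, ‖u x‖ₑ ^ s
      ≤ ∫⁻ x in (Metric.ball (0 : RN N) R)ᶜ,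
          ENNReal.ofReal (A * R ^ (-κ)) ^ (s - p) * ‖u x‖ₑ ^ p := by
        refine lintegral_mono_ae ?_
        filter_upwards [(ae_restrict_iff' Metric.isOpen_ball.measurableSet.compl).2
          (h.le_off_ball hA hκ hR)] with x hx
        exact enorm_rpow_le_mul_rpow hp hps hx
    _ ≤ ∫⁻ x, ENNReal.ofReal (A * R ^ (-κ)) ^ (s - p) * ‖u x‖ₑ ^ p :=
        setLIntegral_le_lintegral _ _
    _ = _ := lintegral_const_mul' _ _
        (ENNReal.rpow_ne_top_of_nonneg (by linarith) ENNReal.ofReal_ne_top)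

theorem HasDecay.lintegral_rpow_lt_top (hN : 1 ≤ N) {u : RN N → ℝ} (h : HasDecay A α κ u)
    (hA : 0 ≤ A) (hα : 0 ≤ α) (hκ : 0 ≤ κ) (hp : 0 < p) (hps : p ≤ s) (hαs : α * s < N)
    (hu : ∫⁻ x, ‖u x‖ₑ ^ p < ∞) : ∫⁻ x, ‖u x‖ₑ ^ s < ∞ := by
  rw [← lintegral_add_compl _ (Metric.isOpen_ball (x := (0 : RN N)) (ε := 1)).measurableSet]
  refine ENNReal.add_lt_top.2 ⟨?_, ?_⟩
  · refine lt_of_le_of_lt (lintegral_mono_ae ?_) (lintegral_ball_rpow_lt_top hN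
      (A := A * 1 ^ α) (by positivity) (hp.trans_le hps) hαs 1)
    filter_upwards [(ae_restrict_iff' Metric.isOpen_ball.measurableSet).2
      (h.le_on_ball hA hα hκ le_rfl)] with x hx
    rw [Real.enorm_eq_ofReal_abs]
    exact ENNReal.rpow_le_rpow (ENNReal.ofReal_le_ofReal hx) (by linarith)
  · exact (h.setLIntegral_compl_le hA hκ hp hps le_rfl).trans_lt (ENNReal.mul_lt_top
      (ENNReal.rpow_lt_top_of_nonneg (by linarith) ENNReal.ofReal_ne_top) hu)

/-- Convergence in `L^s` of an `L^p`-bounded a.e. null sequence with uniform decay, `p < s`. -/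
theorem tendsto_lintegral_rpow_of_hasDecay (hN : 1 ≤ N) {d : ℕ → RN N → ℝ} {K : ℝ≥0∞}
    (hdm : ∀ n, AEStronglyMeasurable (d n) volume) (h : ∀ n, HasDecay A α κ (d n))
    (hA : 0 ≤ A) (hα : 0 ≤ α) (hκ : 0 < κ) (hp : 0 < p) (hps : p < s) (hαs : α * s < N)
    (hK : K ≠ ∞) (hd : ∀ n, ∫⁻ x, ‖d n x‖ₑ ^ p ≤ K)
    (h0 : ∀ᵐ x, Tendsto (fun n => d n x) atTop (𝓝 0)) :
    Tendsto (fun n => ∫⁻ x, ‖d n x‖ₑ ^ s) atTop (𝓝 0) := by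
  have hs : 0 < s := hp.trans hps
  have htail : Tendsto (fun R : ℝ => ENNReal.ofReal (A * R ^ (-κ)) ^ (s - p) * K) atTop (𝓝 0) := by
    have h1 := ENNReal.tendsto_ofReal ((tendsto_rpow_neg_atTop hκ).const_mul A)
    rw [mul_zero, ENNReal.ofReal_zero] at h1
    have h2 := ((ENNReal.continuous_rpow_const (y := s - p)).tendsto 0).comp h1
    rw [ENNReal.zero_rpow_of_pos (by linarith)] at h2
    simpa using ENNReal.Tendsto.mul_const h2 (Or.inr hK)
  rw [ENNReal.tendsto_nhds_zero]
  intro ε hε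
  have hε2 : 0 < ε / 2 := ENNReal.half_pos hε.ne'
  obtain ⟨R, hR, hR1⟩ := ((ENNReal.tendsto_nhds_zero.1 htail _ hε2).and
    (eventually_ge_atTop 1)).exists
  have hR0 : 0 < R := by linarith
  have hball : Tendsto (fun n => ∫⁻ x in Metric.ball (0 : RN N) R, ‖d n x‖ₑ ^ s) atTop (𝓝 0) := by
    have h3 := tendsto_lintegral_of_dominated_convergence'
      (μ := volume.restrict (Metric.ball (0 : RN N) R)) (F := fun n x => ‖d n x‖ₑ ^ s)
      (f := fun _ => 0) (fun x => ENNReal.ofReal (A * R ^ α * ‖x‖ ^ (-α)) ^ s)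
      (fun n => ((hdm n).restrict.enorm.pow_const _))
      (fun n => by
        filter_upwards [(ae_restrict_iff' Metric.isOpen_ball.measurableSet).2
          ((h n).le_on_ball hA hα hκ.le hR1)] with x hx
        rw [Real.enorm_eq_ofReal_abs]
        exact ENNReal.rpow_le_rpow (ENNReal.ofReal_le_ofReal hx) hs.le)
      (lintegral_ball_rpow_lt_top hN (by positivity) hs hαs R).ne
      (by
        filter_upwards [ae_restrict_of_ae h0] with x hx
        have h4 := ((ENNReal.continuous_rpow_const (y := s)).tendsto _).comp hx.enorm
        simpa [Function.comp_def, ENNReal.zero_rpow_of_pos hs] using h4)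
    simpa using h3
  filter_upwards [ENNReal.tendsto_nhds_zero.1 hball _ hε2] with n hn
  rw [← lintegral_add_compl _ (Metric.isOpen_ball (x := (0 : RN N)) (ε := R)).measurableSet,
    ← ENNReal.add_halves ε]
  refine add_le_add hn (((h n).setLIntegral_compl_le hA hκ.le hp hps.le hR1).trans ?_)
  exact (mul_le_mul_right (hd n) _).trans hR

end Decay

/-! ### Extraction of pointwise convergent subsequences -/

/-- A pointwise bounded sequence of real families with countable index set has a subsequence
converging at every index. -/
theorem exists_subseq_tendsto_of_countable {ι : Type*} [Countable ι] (v : ℕ → ι → ℝ) (B : ι → ℝ)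
    (hv : ∀ n k, |v n k| ≤ B k) :
    ∃ φ : ℕ → ℕ, StrictMono φ ∧ ∀ k, ∃ l, Tendsto (fun n => v (φ n) k) atTop (𝓝 l) := by
  -- Tychonoff in place of a diagonal argument; countability of the index set makes the product
  -- first countable, so compactness yields subsequences.
  have hc : IsCompact (univ.pi fun k => Icc (-B k) (B k)) :=
    isCompact_univ_pi fun k => isCompact_Icc
  obtain ⟨a, -, φ, hφ, hlim⟩ := hc.tendsto_subseq (x := v)
    (fun n => fun k _ => ⟨neg_le_of_abs_le (hv n k), le_of_abs_le (hv n k)⟩)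
  exact ⟨φ, hφ, fun k => ⟨a k, (tendsto_pi_nhds.1 hlim) k⟩⟩

/-- A family of functions, indexed also by a finite type, with a common Hölder-type modulus in the
radius has a subsequence that converges pointwise. -/
theorem exists_subseq_tendsto_of_modulus {N : ℕ} {ι : Type*} [Finite ι]
    {u : ℕ → ι → RN N → ℝ} {E : Set (RN N)} {A κ θ : ℝ} (hA : 0 ≤ A) (hκ : 0 ≤ κ) (hθ : 0 < θ)
    (hE0 : ∀ x ∈ E, x ≠ 0) (hb : ∀ n i, ∀ x ∈ E, |u n i x| ≤ A * ‖x‖ ^ (-κ))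
    (hosc : ∀ n i, ∀ x ∈ E, ∀ y ∈ E, ‖x‖ ≤ ‖y‖ →
      |u n i y - u n i x| ≤ A * (‖x‖ ^ (-κ) * (‖y‖ - ‖x‖) ^ θ)) :
    ∃ φ : ℕ → ℕ, StrictMono φ ∧
      ∀ i, ∀ x ∈ E, ∃ l, Tendsto (fun n => u (φ n) i x) atTop (𝓝 l) := by
  obtain ⟨t, htc, htd⟩ := TopologicalSpace.exists_countable_dense E
  have := htc.to_subtype
  obtain ⟨φ, hφ, hlim⟩ := exists_subseq_tendsto_of_countable
    (fun n (k : t × ι) => u n k.2 k.1.1) (fun k => A * ‖(k.1.1 : RN N)‖ ^ (-κ))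
    (fun n k => hb n k.2 _ k.1.1.2)
  refine ⟨φ, hφ, fun i x hx => ?_⟩
  have hx0 : 0 < ‖x‖ := norm_pos_iff.2 (hE0 x hx)
  -- Staying at norm at least |x|/2 bounds |·|^{-κ}, which gives a modulus of continuity at x
  -- independent of n and of which of the two points is the inner one.
  have hmod : ∀ n, ∀ y ∈ E, ‖x‖ / 2 ≤ ‖y‖ →
      |u n i y - u n i x| ≤ A * ((‖x‖ / 2) ^ (-κ) * ‖y - x‖ ^ θ) := by
    intro n y hy hxy
    have hdist := abs_norm_sub_norm_le y x
    rcases le_total ‖x‖ ‖y‖ with hle | hle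
    · refine (hosc n i x hx y hy hle).trans ?_
      have h1 : ‖y‖ - ‖x‖ ≤ ‖y - x‖ := (le_abs_self _).trans hdist
      have h2 : ‖x‖ ^ (-κ) ≤ (‖x‖ / 2) ^ (-κ) :=
        Real.rpow_le_rpow_of_nonpos (by positivity) (by linarith) (by linarith)
      have h3 : 0 ≤ ‖y‖ - ‖x‖ := by linarith
      gcongr
    · rw [abs_sub_comm]
      refine (hosc n i y hy x hx hle).trans ?_
      have h1 : ‖x‖ - ‖y‖ ≤ ‖y - x‖ := by
        rw [abs_sub_comm] at hdist
        exact (le_abs_self _).trans hdist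
      have h2 : ‖y‖ ^ (-κ) ≤ (‖x‖ / 2) ^ (-κ) :=
        Real.rpow_le_rpow_of_nonpos (by positivity) hxy (by linarith)
      have h3 : 0 ≤ ‖x‖ - ‖y‖ := by linarith
      gcongr
  refine cauchySeq_tendsto_of_complete (Metric.cauchySeq_iff'.2 fun ε hε => ?_)
  have hsmall : ∀ᶠ y : E in 𝓝 ⟨x, hx⟩,
      A * ((‖x‖ / 2) ^ (-κ) * ‖(y : RN N) - x‖ ^ θ) < ε / 3 ∧ ‖x‖ / 2 < ‖(y : RN N)‖ := by
    refine Filter.Eventually.and ?_ ?_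
    · have hc : ContinuousAt (fun y : E => A * ((‖x‖ / 2) ^ (-κ) * ‖(y : RN N) - x‖ ^ θ))
          ⟨x, hx⟩ := by
        refine continuousAt_const.mul (continuousAt_const.mul
          (ContinuousAt.rpow_const ?_ (Or.inr hθ.le)))
        fun_prop
      have h0 : A * ((‖x‖ / 2) ^ (-κ) * ‖((⟨x, hx⟩ : E) : RN N) - x‖ ^ θ) < ε / 3 := by
        simp only [sub_self, norm_zero, Real.zero_rpow hθ.ne', mul_zero]
        positivity
      exact hc.eventually_lt_const h0
    · have hc : Continuous fun y : E => ‖(y : RN N)‖ := by fun_prop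
      exact hc.continuousAt.eventually_const_lt (by simp only; linarith)
  obtain ⟨y, hyt, hy1, hy2⟩ := htd.exists_mem_open isOpen_interior
    ⟨_, mem_interior_iff_mem_nhds.2 hsmall⟩ |>.imp fun y hy =>
      (⟨hy.1, interior_subset hy.2⟩ : y ∈ t ∧ _)
  obtain ⟨l, hl⟩ := hlim ⟨⟨y, hyt⟩, i⟩
  obtain ⟨n₀, hn₀⟩ := Metric.cauchySeq_iff'.1 hl.cauchySeq (ε / 3) (by positivity)
  refine ⟨n₀, fun n hn => ?_⟩
  have h1 := hmod (φ n) y y.2 hy2.le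
  have h2 := hmod (φ n₀) y y.2 hy2.le
  have h3 := hn₀ n hn
  rw [Real.dist_eq] at h3 ⊢
  calc |u (φ n) i x - u (φ n₀) i x|
      = |(u (φ n) i y - u (φ n₀) i y) - (u (φ n) i y - u (φ n) i x) +
          (u (φ n₀) i y - u (φ n₀) i x)| := by ring_nf
    _ ≤ |u (φ n) i y - u (φ n₀) i y| + |u (φ n) i y - u (φ n) i x| +
          |u (φ n₀) i y - u (φ n₀) i x| :=
        (abs_add_le _ _).trans (add_le_add_left (abs_sub _ _) _)
    _ < ε := by linarith

/-! ### Compact embedding of the radial Sobolev space -/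

section RadialCompactness

variable {N : ℕ} {p r : ℝ}

theorem IsCriticalExponent.lt (hp : 1 < p) (hr : IsCriticalExponent N p r) :
    p < r := by
  rcases lt_or_ge p N with h | h
  · have hp0 : 0 < p := by linarith
    rw [hr.1 h, lt_div_iff₀ (by linarith)]
    nlinarith
  · exact hr.2 h

/-- For p < N take α = (N-p)/p: then αs < N is precisely s < pN/(N-p). For p ≥ N the lower bound is
nonpositive and any small positive α works; N/(2s) makes αs = N/2. -/
theorem IsCriticalExponent.exists_exponent (hN : 1 ≤ N) (hp : 1 < p)
    (hr : IsCriticalExponent N p r) {s : ℝ} (hs : s ∈ Ioo p r) :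
    ∃ α : ℝ, 0 < α ∧ ((N : ℝ) - p) / p ≤ α ∧ α * s < N := by
  have hp0 : 0 < p := by linarith
  have hs0 : 0 < s := hp0.trans hs.1
  have hN0 : (0 : ℝ) < N := by exact_mod_cast hN
  rcases lt_or_ge p N with h | h
  · have h1 : 0 < (N : ℝ) - p := by linarith
    refine ⟨((N : ℝ) - p) / p, by positivity, le_rfl, ?_⟩
    have h2 := hs.2
    rw [hr.1 h, lt_div_iff₀ h1] at h2
    rw [div_mul_eq_mul_div, div_lt_iff₀ hp0]
    linarith
  · refine ⟨N / (2 * s), by positivity, ?_, ?_⟩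
    · exact (div_nonpos_of_nonpos_of_nonneg (by linarith) hp0.le).trans (by positivity)
    · rw [div_mul_eq_mul_div, div_lt_iff₀ (by positivity)]
      nlinarith

theorem exists_hasDecay [Fact (1 < p)] (hN : 1 ≤ N) {α : ℝ} (hα : 0 < α)
    (hαN : ((N : ℝ) - p) / p ≤ α) :
    ∃ C : ℝ, 0 < C ∧ ∀ M : ℝ, 0 ≤ M → ∀ w ∈ SobolevRadial N p, ‖w‖ ≤ M →
      HasDecay (C * M) α (((N - 1 : ℕ) : ℝ) / p) (w.1 : RN N → ℝ) := by
  obtain ⟨C, hC, h⟩ := exists_radial_bounds (p := p) hN hα hαN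
  refine ⟨C, hC, fun M hM w hw hwM => ?_⟩
  obtain ⟨E, hE, -, h1, h2, -⟩ := h M hM w hw hwM
  filter_upwards [hE] with x hx
  exact ⟨h2 x hx, fun _ => h1 x hx⟩

theorem HasDecay.of_tendsto {A α κ : ℝ} {u : ℕ → RN N → ℝ} {u' : RN N → ℝ}
    (h : ∀ n, HasDecay A α κ (u n))
    (hlim : ∀ᵐ x, Tendsto (fun n => u n x) atTop (𝓝 (u' x))) : HasDecay A α κ u' := by
  filter_upwards [ae_all_iff.2 h, hlim] with x hx hl
  exact ⟨fun h1 => le_of_tendsto' hl.abs fun n => (hx n).1 h1,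
    fun h1 => le_of_tendsto' hl.abs fun n => (hx n).2 h1⟩

theorem HasDecay.sub {A α κ : ℝ} {u v : RN N → ℝ} (hu : HasDecay A α κ u)
    (hv : HasDecay A α κ v) : HasDecay (2 * A) α κ (fun x => u x - v x) := by
  filter_upwards [hu, hv] with x hx hy
  refine ⟨fun h1 => (abs_sub _ _).trans ?_, fun h1 => (abs_sub _ _).trans ?_⟩
  · linarith [hx.1 h1, hy.1 h1]
  · linarith [hx.2 h1, hy.2 h1]

/-- Stands in for the Sobolev embedding: |x|^{-αs} is integrable near the origin, and boundedness
away from it together with u ∈ L^p handles the rest. Only the open range of s is obtained, which is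
all that is used. -/
theorem lintegral_rpow_lt_top_of_mem_sobolevRadial [Fact (1 < p)] (hN : 1 ≤ N)
    (hr : IsCriticalExponent N p r) {w : LpPair N p} (hw : w ∈ SobolevRadial N p) {s : ℝ}
    (hs : s ∈ Ioo p r) : ∫⁻ x, ‖w.1 x‖ₑ ^ s < ∞ := by
  have hp : 1 < p := Fact.out
  have hp0 : 0 < p := by linarith
  obtain ⟨α, hα, hαN, hαs⟩ := hr.exists_exponent hN hp hs
  obtain ⟨C, hC, h⟩ := exists_hasDecay (p := p) hN hα hαN
  exact (h ‖w‖ (norm_nonneg _) w hw le_rfl).lintegral_rpow_lt_top hN (by positivity) hα.le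
    (by positivity) hp0 hs.1.le hαs (Lp.lintegral_rpow_lt_top hp0 w.1)

/-- Compactness of the embeddings of the radial Sobolev space in `L^s`, `p < s < p^*`, together
with a.e. convergence, along one subsequence for finitely many components. -/
theorem exists_subseq_tendsto_sobolevRadial [Fact (1 < p)] {ι : Type*} [Finite ι] (hN : 2 ≤ N)
    (hr : IsCriticalExponent N p r) {M : ℝ} (hM : 0 ≤ M) {w : ℕ → ι → LpPair N p}
    (hw : ∀ n i, w n i ∈ SobolevRadial N p) (hwM : ∀ n i, ‖w n i‖ ≤ M) :
    ∃ φ : ℕ → ℕ, StrictMono φ ∧ ∃ U : ι → RN N → ℝ,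
      (∀ i, AEStronglyMeasurable (U i) volume) ∧
      (∀ i, ∀ᵐ x, Tendsto (fun n => (w (φ n) i).1 x) atTop (𝓝 (U i x))) ∧
      (∀ i, ∀ s ∈ Ioo p r, ∫⁻ x, ‖U i x‖ₑ ^ s < ∞) ∧
      ∀ i, ∀ s ∈ Ioo p r,
        Tendsto (fun n => ∫⁻ x, ‖(w (φ n) i).1 x - U i x‖ₑ ^ s) atTop (𝓝 0) := by
  have hp : 1 < p := Fact.out
  have hp0 : 0 < p := by linarith
  have hp1 : 0 < p - 1 := by linarith
  have hN1 : 1 ≤ N := by omega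
  have hκ : 0 < ((N - 1 : ℕ) : ℝ) / p := by
    have : (0 : ℝ) < ((N - 1 : ℕ) : ℝ) := by exact_mod_cast (by omega : 0 < N - 1)
    positivity
  -- Here only the decay and the modulus are used, so any admissible α will do. The bound near the
  -- origin is invoked later, with an α adapted to s.
  obtain ⟨C, hC, hbd⟩ := exists_radial_bounds (p := p) hN1
    (α := max 1 (((N : ℝ) - p) / p)) (by positivity) (le_max_right _ _)
  choose E hE hE0 hb _hnear hosc using fun n i => hbd M hM (w n i) (hw n i) (hwM n i)
  let E' : Set (RN N) := {x | ∀ n i, x ∈ E n i}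
  have hE' : ∀ᵐ x, x ∈ E' := ae_all_iff.2 fun n => ae_all_iff.2 fun i => hE n i
  -- An index is needed to know that E' omits the origin.
  rcases isEmpty_or_nonempty ι with hι | ⟨⟨i₀⟩⟩
  · exact ⟨id, strictMono_id, fun _ _ => 0, fun i => hι.elim i, fun i => hι.elim i,
      fun i => hι.elim i, fun i => hι.elim i⟩
  obtain ⟨φ, hφ, hlim⟩ := exists_subseq_tendsto_of_modulus (E := E')
    (u := fun n i => ((w n i).1 : RN N → ℝ)) (A := C * M) (κ := ((N - 1 : ℕ) : ℝ) / p)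
    (θ := (p - 1) / p) (by positivity) hκ.le (by positivity)
    (fun x hx => hE0 0 i₀ x (hx 0 i₀)) (fun n i x hx => hb n i x (hx n i))
    (fun n i x hx y hy hxy => hosc n i x (hx n i) y (hy n i) hxy)
  have hmeas : ∀ n i, AEStronglyMeasurable ((w n i).1 : RN N → ℝ) volume := fun n i =>
    Lp.aestronglyMeasurable _
  have hex : ∀ i, ∃ U : RN N → ℝ, StronglyMeasurable U ∧
      ∀ᵐ x, Tendsto (fun n => (w (φ n) i).1 x) atTop (𝓝 (U x)) := fun i =>
    exists_stronglyMeasurable_limit_of_tendsto_ae (fun n => hmeas (φ n) i)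
      (by filter_upwards [hE'] with x hx using hlim i x hx)
  choose U hUm hU using hex
  have hbound : ∀ n i, ∫⁻ x, ‖(w n i).1 x‖ₑ ^ p ≤ ENNReal.ofReal M ^ p := fun n i =>
    lintegral_rpow_le_of_norm_le hp0 ((norm_fst_le _).trans (hwM n i))
  have hUp : ∀ i, ∫⁻ x, ‖U i x‖ₑ ^ p ≤ ENNReal.ofReal M ^ p := by
    intro i
    calc ∫⁻ x, ‖U i x‖ₑ ^ p
        = ∫⁻ x, liminf (fun n => ‖(w (φ n) i).1 x‖ₑ ^ p) atTop := by
          refine lintegral_congr_ae ?_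
          filter_upwards [hU i] with x hx
          exact ((((ENNReal.continuous_rpow_const (y := p)).tendsto _).comp
            hx.enorm).liminf_eq).symm
      _ ≤ liminf (fun n => ∫⁻ x, ‖(w (φ n) i).1 x‖ₑ ^ p) atTop :=
          lintegral_liminf_le' fun n => (hmeas _ i).enorm.pow_const _
      _ ≤ _ := liminf_le_of_frequently_le' (Frequently.of_forall fun n => hbound _ i)
  have hMt : ENNReal.ofReal M ^ p ≠ ∞ :=
    ENNReal.rpow_ne_top_of_nonneg hp0.le ENNReal.ofReal_ne_top
  have hdiff : ∀ n i, ∫⁻ x, ‖(w n i).1 x - U i x‖ₑ ^ p ≤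
      2 ^ (p - 1) * (ENNReal.ofReal M ^ p + ENNReal.ofReal M ^ p) := by
    intro n i
    calc ∫⁻ x, ‖(w n i).1 x - U i x‖ₑ ^ p
        ≤ ∫⁻ x, 2 ^ (p - 1) * (‖(w n i).1 x‖ₑ ^ p + ‖U i x‖ₑ ^ p) :=
          lintegral_mono fun x => enorm_sub_rpow_le hp.le _ _
      _ = 2 ^ (p - 1) * ((∫⁻ x, ‖(w n i).1 x‖ₑ ^ p) + ∫⁻ x, ‖U i x‖ₑ ^ p) := by
          rw [lintegral_const_mul' _ _ (ENNReal.rpow_ne_top_of_nonneg hp1.le (by simp)),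
            lintegral_add_left' ((hmeas n i).enorm.pow_const _)]
      _ ≤ _ := by
          gcongr
          · exact hbound n i
          · exact hUp i
  refine ⟨φ, hφ, U, fun i => (hUm i).aestronglyMeasurable, hU, fun i s hs => ?_, fun i s hs => ?_⟩
  -- The exponent α depends on s, whereas the subsequence and its limit were fixed before s; the
  -- limit inherits the decay for each α.
  all_goals
    obtain ⟨α, hα, hαN, hαs⟩ := hr.exists_exponent hN1 hp hs
    obtain ⟨C', hC', h'⟩ := exists_hasDecay (p := p) hN1 hα hαN
    have hdec := fun n => h' M hM (w (φ n) i) (hw _ i) (hwM _ i)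
    have hdec' := HasDecay.of_tendsto hdec (hU i)
  · exact hdec'.lintegral_rpow_lt_top hN1 (by positivity) hα.le hκ.le hp0 hs.1.le hαs
      ((hUp i).trans_lt hMt.lt_top)
  · refine tendsto_lintegral_rpow_of_hasDecay hN1
      (fun n => (hmeas _ i).sub (hUm i).aestronglyMeasurable) (fun n => (hdec n).sub hdec')
      (by positivity) hα.le hκ hp0 hs.1 hαs
      (K := 2 ^ (p - 1) * (ENNReal.ofReal M ^ p + ENNReal.ofReal M ^ p)) ?_
      (fun n => hdiff (φ n) i) ?_
    · exact ENNReal.mul_ne_top (ENNReal.rpow_ne_top_of_nonneg hp1.le (by simp))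
        (ENNReal.add_ne_top.2 ⟨hMt, hMt⟩)
    · filter_upwards [hU i] with x hx
      simpa using hx.sub_const (U i x)

end RadialCompactness

/-! ### Compactness of the nonlocal term and conclusion -/

theorem IsAdmissible.nonlocalCompactOn {N m : ℕ} {G : (Fin m → ℝ) → ℝ} {V : ℝ → ℝ}
    {K p r a₁ a₂ : ℝ} {μ : Fin m → ℝ} [Fact (1 < p)] (hN : 2 ≤ N)
    (hr : IsCriticalExponent N p r)
    (h : IsAdmissible G (fun x : RN N => V ‖x‖) K p r μ a₁ a₂) {D : Set (Fin m → LpPair N p)}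
    (hDrad : ∀ U ∈ D, ∀ i, U i ∈ SobolevRadial N p)
    (hD : ∀ U ∈ D, ∀ᵐ x, |compG G (fun i => ((U i).1 : RN N → ℝ)) x| ≤
      K * ∑ i, |((U i).1 : RN N → ℝ) x| ^ μ i) :
    NonlocalCompactOn G V D := by
  have hgood : ∀ U : D, IsGood G K p r μ (fun i => ((U.1 i).1 : RN N → ℝ)) := fun U =>
    ⟨fun i => Lp.aestronglyMeasurable _, hD U.1 U.2, fun i s hs =>
      lintegral_rpow_lt_top_of_mem_sobolevRadial (by omega) hr (hDrad U.1 U.2 i) hs⟩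
  choose Q hQ using fun U : D => h.exists_isNonlocalTerm (hgood U)
  refine ⟨Q, hQ, fun B hB => isCompact_closure_of_subseq fun y hy => ?_⟩
  choose U hUB hUy using hy
  obtain ⟨M, hM⟩ := (Bornology.isBounded_image_subtype_val.2 hB).exists_norm_le
  have hUM : ∀ n i, ‖(U n).1 i‖ ≤ max M 0 := fun n i =>
    ((norm_le_pi_norm _ i).trans (hM _ ⟨U n, hUB n, rfl⟩)).trans (le_max_left _ _)
  obtain ⟨φ, hφ, U', hm', hae, hint, hlim⟩ := exists_subseq_tendsto_sobolevRadial hN hr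
    (le_max_right M 0) (w := fun n => (U n).1) (fun n i => hDrad _ (U n).2 i) hUM
  -- U' is not shown to belong to D or to W^{1,p}; the inherited growth and integrability are enough
  -- to define its nonlocal term, which is the limit in L^1.
  have hgood' : IsGood G K p r μ U' :=
    ⟨hm', growth_of_tendsto h.cont h.pos (fun n => (hgood (U (φ n))).growth) hae, hint⟩
  obtain ⟨w', hw'⟩ := h.exists_isNonlocalTerm hgood'
  refine ⟨w', φ, hφ, ?_⟩
  have key := h.tendsto_of_isNonlocalTerm (fun n => hgood (U (φ n))) hgood' hae hlim
    (fun n => hQ (U (φ n))) hw'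
  exact key.congr fun n => hUy (φ n)

/-- The sign restriction enters the theorem only through this growth bound in |U_i|. The condition
G(s) ≤ G(|s|) plays the same role in the next lemma, so both parts share one proof. -/
theorem abs_compG_le_of_nonneg {N m : ℕ} {G : (Fin m → ℝ) → ℝ} (hG : ∀ s, 0 ≤ G s) {K : ℝ}
    {μ : Fin m → ℝ} (hg : ∀ s : Fin m → ℝ, (∀ i, 0 ≤ s i) → G s ≤ K * ∑ i, s i ^ μ i)
    {U : Fin m → RN N → ℝ} (hU : NonnegAE U) :
    ∀ᵐ x, |compG G U x| ≤ K * ∑ i, |U i x| ^ μ i := by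
  filter_upwards [ae_all_iff.2 hU] with x hx
  rw [compG, abs_of_nonneg (hG _)]
  simpa only [abs_of_nonneg (hx _)] using hg _ hx

theorem abs_compG_le_of_le_abs {N m : ℕ} {G : (Fin m → ℝ) → ℝ} (hG : ∀ s, 0 ≤ G s) {K : ℝ}
    {μ : Fin m → ℝ} (hg : ∀ s : Fin m → ℝ, (∀ i, 0 ≤ s i) → G s ≤ K * ∑ i, s i ^ μ i)
    (habs : ∀ s : Fin m → ℝ, G s ≤ G (fun i => |s i|)) (U : Fin m → RN N → ℝ) :
    ∀ᵐ x, |compG G U x| ≤ K * ∑ i, |U i x| ^ μ i := by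
  refine Eventually.of_forall fun x => ?_
  rw [compG, abs_of_nonneg (hG _)]
  exact (habs _).trans (hg _ fun i => abs_nonneg _)

end

theorem proposition3p4 (N m : ℕ) (hN : 1 ≤ N) (p pstar q : ℝ)
    [Fact (1 < p)] [Fact (1 < pstar)] (hpstar : IsCriticalExponent N p pstar) (hq : 1 < q)
    -- the nonlinearity and the potential
    (G : (Fin m → ℝ) → ℝ) (hGcont : Continuous G) (hGnonneg : ∀ s, 0 ≤ G s)
    (V : ℝ → ℝ) (hVnonneg : ∀ t, 0 ≤ t → 0 ≤ V t)
    -- growth of the nonlinearity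
    (K' : ℝ) (hK' : 0 < K') (μ : Fin m → ℝ)
    (hG1 : ∀ s : Fin m → ℝ, (∀ i, 0 ≤ s i) → G s ≤ K' * ∑ i, s i ^ μ i)
    (hμ_lower : ∀ i, p * ((2 * q - 1) / (2 * q)) < μ i)
    (hμ_upper : ∀ i, μ i < pstar * ((2 * q - 1) / (2 * q)))
    -- integrability of the potential
    (hG2 : MemWeakLp (fun x : RN N => V ‖x‖) q)
    (hμ_mass : ∀ i, (N : ℝ) * (μ i / p - (2 * q - 1) / (2 * q)) < p / 2) :
    -- without further assumptions, on functions with nonnegative components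
    (NonlocalContinuousOn G V
        {U : Fin m → LpInter N p pstar | NonnegAE fun i => ((U i).1 : RN N → ℝ)} ∧
      (2 ≤ N → NonlocalCompactOn G V
        {U : Fin m → LpPair N p | (∀ i, U i ∈ SobolevRadial N p) ∧
          NonnegAE fun i => ((U i).1 : RN N → ℝ)})) ∧
    -- if `G(s) ≤ G(|s|)` for all `s`, on the full spaces
    ((∀ s : Fin m → ℝ, G s ≤ G (fun i => |s i|)) →
      NonlocalContinuousOn G V (Set.univ : Set (Fin m → LpInter N p pstar)) ∧
      (2 ≤ N → NonlocalCompactOn G V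
        {U : Fin m → LpPair N p | ∀ i, U i ∈ SobolevRadial N p})) := by
  have hp : 1 < p := Fact.out
  obtain ⟨a₁, a₂, h⟩ := exists_isAdmissible (v := fun x : RN N => V ‖x‖) (K := K') hGcont hK'.le
    hp hq hG2 (fun x => hVnonneg _ (norm_nonneg x)) hμ_lower hμ_upper
  have hlt := (hpstar.lt hp).le
  refine ⟨⟨h.nonlocalContinuousOn hlt fun U hU => abs_compG_le_of_nonneg hGnonneg hG1 hU,
    fun hN2 => h.nonlocalCompactOn hN2 hpstar (fun U hU => hU.1)
      fun U hU => abs_compG_le_of_nonneg hGnonneg hG1 hU.2⟩, fun habs => ?_⟩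
  exact ⟨h.nonlocalContinuousOn hlt fun U _ => abs_compG_le_of_le_abs hGnonneg hG1 habs _,
    fun hN2 => h.nonlocalCompactOn hN2 hpstar (fun U hU => hU)
      fun U _ => abs_compG_le_of_le_abs hGnonneg hG1 habs _⟩
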